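/- **Conventions.** A *cube complex* is a complex of Euclidean unit cubes in which every cube is embedded and any two cubes that meet intersect in a common face. It is *CAT(0)* if it is simply connected and the link of every vertex is a flag complex (no finiteness of any kind is assumed). Its hyperplanes are dual to the classes of edges under the equivalence relation generated by being opposite edges of a square; its *halfspaces* $\Phi\in\mathcal H(X)$ are the connected components of complements of hyperplanes, regarded as sets of vertices, and $\overline\Phi$ denotes the complement of $\Phi$. Halfspaces $\Phi,\Psi$ are *nested* if $\Phi\subseteq\Psi$, $\overline\Phi\subseteq\Psi$, $\Phi\subseteq\overline\Psi$ or $\overline\Phi\subseteq\overline\Psi$, and *transverse* otherwise. Distinct nested halfspaces $\Phi,\Psi$ are *tightly nested* if there is no $\Theta\in\mathcal H(X)$ with $\Phi'\subsetneq\Theta\subsetneq\Psi'$ for some $\Phi'\in\{\Phi,\overline\Phi\}$, $\Psi'\in\{\Psi,\overline\Psi\}$. An action of a group $G$ by automorphisms on a CAT(0) cube complex $X$ is *RAAG-like* if 1. there are no $\Phi\in\mathcal H(X)$, $h\in G$ with $h\overline\Phi=\Phi$; 2. there are no $\Phi\in\mathcal H(X)$, $h\in G$ with $\Phi$ and $h\Phi$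 transverse; 3. there are no tightly nested $\Phi,\Phi'\in\mathcal H(X)$ and $h\in G$ with $\Phi$ and $h\Phi'$ transverse; 4. there are no $\Phi\in\mathcal H(X)$, $h\in G$ with $\Phi\subseteq h\overline\Phi$ and $\Phi$, $h\overline\Phi$ tightly nested. A group is *RAAG-like* if it has a faithful RAAG-like action on some CAT(0) cube complex. The *right-angled Artin group* (RAAG) of a simplicial graph $\Gamma$ is generated by the vertices of $\Gamma$, subject to the relations that adjacent vertices commute. For $g\in[G,G]$ let $\mathrm{cl}(g)$ be the minimal number of commutators whose product is $g$, and let $\mathrm{scl}(g)=\lim_{n\to\infty}\mathrm{cl}(g^n)/n$ (the limit exists). A group $G$ has a *stable commutator length gap* of $c$ if $\mathrm{scl}(g)\ge c$ for every $g\in[G,G]$ with $g\neq1$. **Corollary.** Let $G$ be a group with a RAAG-like action on a CAT(0) cube complex. Then every $g\in[G,G]$ that acts non-trivially satisfies $$\mathrm{scl}(g)\ge\tfrac1{24}.$$ In particular, every RAAG-like group has a stable commutator length gap of $1/24$. Hence so does every right-angled Artin group. -/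

import Mathlib

open Filter Topology
open scoped Pointwise commutatorElement

universe u v w

/-- The face of the combinatorial cube `{0,1}^n` on which the coordinates in `S` agree with
those of `a`. -/
def cubeFace {n : ℕ} (S : Set (Fin n)) (a : Fin n → Bool) : Set (Fin n → Bool) :=
  {x | ∀ i ∈ S, x i = a i}

/-- A cube complex with vertex set `V`, each cube being recorded by its set of vertices: cubes
are embedded copies of `{0,1}^n` (for some `n`), the subcubes of a cube are exactly its faces,
and two cubes that meet do so in a common face. -/
structure CubeComplex (V : Type*) where
  cubes : Set (Set V)
  singleton_mem : ∀ v : V, {v} ∈ cubes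
  exists_param : ∀ C ∈ cubes, ∃ (n : ℕ) (f : (Fin n → Bool) → V), Function.Injective f ∧
    Set.range f = C ∧ ∀ D ⊆ C, (D ∈ cubes ↔ ∃ S a, D = f '' cubeFace S a)
  inter_mem : ∀ C ∈ cubes, ∀ D ∈ cubes, (C ∩ D).Nonempty → C ∩ D ∈ cubes

namespace CubeComplex

variable {V : Type*} (X : CubeComplex V)

/-- The 1-skeleton. -/
def skeleton : SimpleGraph V where
  Adj u v := u ≠ v ∧ ({u, v} : Set V) ∈ X.cubes
  symm := ⟨fun u v h => ⟨h.1.symm, by rw [Set.pair_comm]; exact h.2⟩⟩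
  loopless := ⟨fun _ h => h.1 rfl⟩

/-- `a, b, c, d` are, in cyclic order, the vertices of a 2-cube. -/
structure IsSquare (a b c d : V) : Prop where
  adj_ab : X.skeleton.Adj a b
  adj_bc : X.skeleton.Adj b c
  adj_cd : X.skeleton.Adj c d
  adj_da : X.skeleton.Adj d a
  ne_ac : a ≠ c
  ne_bd : b ≠ d
  mem : ({a, b, c, d} : Set V) ∈ X.cubes

/-- Homotopy of edge paths relative to their endpoints: the congruence generated by removing
backtracks and by pushing across squares. -/
inductive Homotopic : ∀ {u v : V}, X.skeleton.Walk u v → X.skeleton.Walk u v → Prop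
  | refl {u v : V} (p : X.skeleton.Walk u v) : Homotopic p p
  | symm {u v : V} {p q : X.skeleton.Walk u v} : Homotopic p q → Homotopic q p
  | trans {u v : V} {p q r : X.skeleton.Walk u v} :
      Homotopic p q → Homotopic q r → Homotopic p r
  | append {u v w : V} {p p' : X.skeleton.Walk u v} {q q' : X.skeleton.Walk v w} :
      Homotopic p p' → Homotopic q q' → Homotopic (p.append q) (p'.append q')
  | backtrack {u v : V} (h : X.skeleton.Adj u v) :
      Homotopic (.cons h (.cons h.symm .nil)) .nil
  | square {a b c d : V} (h : X.IsSquare a b c d) :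
      Homotopic (.cons h.adj_ab (.cons h.adj_bc .nil))
        (.cons h.adj_da.symm (.cons h.adj_cd.symm .nil))

/-- The complex is (nonempty,) connected and its edge path group is trivial. -/
def IsSimplyConnected : Prop :=
  X.skeleton.Connected ∧ ∀ (v : V) (p : X.skeleton.Walk v v), X.Homotopic p .nil

/-- The link of every vertex is a flag complex: finitely many edges at `v` that pairwise lie in
a common cube all lie in a common cube. -/
def HasFlagLinks : Prop :=
  ∀ (v : V) (S : Set V), S.Finite → (∀ u ∈ S, X.skeleton.Adj v u) →
    (∀ u ∈ S, ∀ u' ∈ S, u ≠ u' → ∃ C ∈ X.cubes, v ∈ C ∧ u ∈ C ∧ u' ∈ C) →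
    ∃ C ∈ X.cubes, v ∈ C ∧ S ⊆ C

/-- CAT(0) cube complexes: simply connected with flag links. -/
structure IsCAT0 : Prop where
  simplyConnected : X.IsSimplyConnected
  flag : X.HasFlagLinks

/-- `e` and `e'` are opposite edges of a square. -/
def Opposite (e e' : Sym2 V) : Prop :=
  ∃ a b c d, X.IsSquare a b c d ∧ e = s(a, b) ∧ e' = s(d, c)

/-- Two edges are parallel if they are dual to the same hyperplane. -/
def Parallel : Sym2 V → Sym2 V → Prop :=
  Relation.EqvGen X.Opposite

/-- The vertices that can be joined to `a` without crossing the hyperplane dual to the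
edge `ab`. -/
def side (a b : V) : Set V :=
  {x | (X.skeleton.deleteEdges {e | X.Parallel s(a, b) e}).Reachable a x}

/-- Halfspaces, as sets of vertices: the components of the complement of a hyperplane. -/
def halfspaces : Set (Set V) :=
  {Φ | ∃ a b, X.skeleton.Adj a b ∧ Φ = X.side a b}

/-- Nestedness of halfspaces. -/
def Nested (Φ Ψ : Set V) : Prop :=
  Φ ⊆ Ψ ∨ Φᶜ ⊆ Ψ ∨ Φ ⊆ Ψᶜ ∨ Φᶜ ⊆ Ψᶜ

/-- Transversality of halfspaces. -/
def Transverse (Φ Ψ : Set V) : Prop :=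
  ¬ Nested Φ Ψ

/-- Distinct nested halfspaces with no halfspace strictly in between, for any choice of
orientations. -/
structure TightlyNested (Φ Ψ : Set V) : Prop where
  ne : Φ ≠ Ψ
  nested : Nested Φ Ψ
  tight : ¬ ∃ Θ ∈ X.halfspaces,
    (Φ ⊂ Θ ∧ Θ ⊂ Ψ) ∨ (Φᶜ ⊂ Θ ∧ Θ ⊂ Ψ) ∨ (Φ ⊂ Θ ∧ Θ ⊂ Ψᶜ) ∨ (Φᶜ ⊂ Θ ∧ Θ ⊂ Ψᶜ)

/-- The action on vertices is an action by automorphisms of the cube complex. -/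
def IsAction (G : Type*) [Group G] [MulAction G V] : Prop :=
  ∀ (g : G), ∀ C ∈ X.cubes, g • C ∈ X.cubes

/-- RAAG-like actions. -/
structure IsRAAGLikeAction (G : Type*) [Group G] [MulAction G V] : Prop where
  isAction : X.IsAction G
  no_inversion : ¬ ∃ Φ ∈ X.halfspaces, ∃ h : G, h • Φᶜ = Φ
  nonTransverse : ¬ ∃ Φ ∈ X.halfspaces, ∃ h : G, Transverse Φ (h • Φ)
  no_interosculation : ¬ ∃ Φ ∈ X.halfspaces, ∃ Φ' ∈ X.halfspaces, ∃ h : G,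
    X.TightlyNested Φ Φ' ∧ Transverse Φ (h • Φ')
  no_selfosculation : ¬ ∃ Φ ∈ X.halfspaces, ∃ h : G,
    Φ ⊆ h • Φᶜ ∧ X.TightlyNested Φ (h • Φᶜ)

end CubeComplex

/-- A group is RAAG-like if it has a faithful RAAG-like action on some CAT(0) cube complex. -/
def IsRAAGLikeGroup (G : Type u) [Group G] : Prop :=
  ∃ (V : Type v) (_ : MulAction G V) (X : CubeComplex V),
    X.IsCAT0 ∧ X.IsRAAGLikeAction G ∧ FaithfulSMul G V

/-- The right-angled Artin group of a graph: one generator for each vertex, and two generators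
commute if they are adjacent. -/
abbrev RAAG {W : Type*} (Γ : SimpleGraph W) : Type _ :=
  PresentedGroup {r : FreeGroup W | ∃ a b, Γ.Adj a b ∧ r = ⁅FreeGroup.of a, FreeGroup.of b⁆}

/-- Commutator length: the minimal number of commutators whose product is `g`
(used for `g` in the commutator subgroup only). -/
noncomputable def commutatorLength {G : Type*} [Group G] (g : G) : ℕ :=
  sInf {n | ∃ l : List G, l.length = n ∧ (∀ x ∈ l, x ∈ commutatorSet G) ∧ l.prod = g}

/-- Stable commutator length. -/
noncomputable def scl {G : Type*} [Group G] (g : G) : ℝ :=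
  limUnder atTop (fun n : ℕ => (commutatorLength (g ^ n) : ℝ) / n)

/-- The limit defining `scl g` exists, and `scl g ≥ c`. -/
def SclAtLeast {G : Type*} [Group G] (g : G) (c : ℝ) : Prop :=
  Tendsto (fun n : ℕ => (commutatorLength (g ^ n) : ℝ) / n) atTop (𝓝 (scl g)) ∧ c ≤ scl g

/-- `G` has a stable commutator length gap of `c`. -/
def HasSclGap (G : Type*) [Group G] (c : ℝ) : Prop :=
  ∀ g ∈ commutator G, g ≠ 1 → SclAtLeast g c

/-! The bound comes from a counting quasimorphism. An element `g` that acts non-trivially shifts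
some halfspace, `g • Φ ⊂ Φ` (`TameAction.exists_shift`). For vertices `x`, `y`, take the largest
number of consecutive, non-overlapping translates of the pair `Φ ⊃ g • Φ` entered on the way from
`x` to `y`, minus the same number from `y` to `x`; this is `chainCount`. Cutting chains at the
median of three vertices, which is encoded by the majority orientation, costs at most one link per
chain. Hence the sum of `chainCount` around a triangle is at most 3 in absolute value, and `h ↦
chainCount g Φ a (h • a)` is an antisymmetric quasimorphism of defect 3.

On `g ^ n` its value is at least `n - 1`: the powers of `g` form a chain, and no translate of the
pair is crossed backwards along the axis (`TameAction.no_reversed`). The latter is where the absence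
of inversions, self-transversality and self-osculation does its work. As such a function grows by at
most 4 · 3 per commutator, `scl g ≥ 1/12`, which is more than required.

The geometry uses only the 2-skeleton with a link condition on three squares at a vertex.
`SquareComplex` isolates this, with simple connectivity phrased as the existence of sections of
coverings. Applied to the covering of classes of reduced paths, this identifies reduced paths with
geodesics (`Reduced.eqv`); the quadrangle condition, convex halfspaces and medians follow. CAT(0)
cube complexes and Cayley complexes of right-angled Artin groups are both instances. For the latter,
edge labels show directly that left translation is tame, so no higher cubes have to be built. -/

/-- A graph with a distinguished family of squares (4-cycles, listed in cyclic order) that satisfies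
the link conditions of a nonpositively curved cube complex, and is simply connected: every covering
datum, consisting of fibres `I x ⊆ T` and of transport maps along edges that are trivial on
backtracks and squares, has a section through each of its points. -/
structure SquareComplex (V : Type u) where
  graph : SimpleGraph V
  Sq : V → V → V → V → Prop
  connected : graph.Connected
  adj : ∀ {a b c d}, Sq a b c d → graph.Adj a b
  ne : ∀ {a b c d}, Sq a b c d → a ≠ c
  rotate : ∀ {a b c d}, Sq a b c d → Sq b c d a
  flip : ∀ {a b c d}, Sq a b c d → Sq a d c b
  unique : ∀ {a b c d d'}, Sq a b c d → Sq a b c d' → d = d'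
  cube : ∀ {v x y z p q r}, Sq v x p y → Sq v y q z → Sq v z r x →
    ∃ s, Sq x p s r ∧ Sq y q s p ∧ Sq z r s q
  develop : ∀ (T : Type u) (act : V → V → T → T) (I : V → Set T),
    (∀ x y, graph.Adj x y → ∀ t ∈ I x, act x y t ∈ I y) →
    (∀ x y, graph.Adj x y → ∀ t ∈ I x, act y x (act x y t) = t) →
    (∀ a b c d, Sq a b c d → ∀ t ∈ I a, act b c (act a b t) = act d c (act a d t)) →
    ∀ u, ∀ t ∈ I u, ∃ φ : V → T, φ u = t ∧ ∀ x y, graph.Adj x y → φ y = act x y (φ x)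

/-! ### Edge paths up to square pushes; reduced paths are the geodesics. -/

namespace SquareComplex

variable {V : Type u} (S : SquareComplex V)

/-- Pushing an edge path across a square. Paths are lists of vertices, the last vertex first. -/
inductive Step : List V → List V → Prop
  | cons {l l' : List V} (x : V) : Step l l' → Step (x :: l) (x :: l')
  | sq {a b c d : V} (l : List V) : S.Sq a b c d → Step (c :: b :: a :: l) (c :: d :: a :: l)

/-- Equivalence of edge paths under pushing across squares. -/
def Eqv : List V → List V → Prop := Relation.ReflTransGen S.Step

variable {S}

theorem Step.symm {l l' : List V} (h : S.Step l l') : S.Step l' l := by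
  induction h with
  | cons x _ ih => exact .cons x ih
  | sq l h => exact .sq l (S.flip h)

protected theorem Eqv.rfl {l : List V} : S.Eqv l l := Relation.ReflTransGen.refl

theorem Eqv.symm {l l' : List V} (h : S.Eqv l l') : S.Eqv l' l := by
  induction h with
  | refl => exact Eqv.rfl
  | tail _ h ih => exact Relation.ReflTransGen.head h.symm ih

theorem Eqv.trans {l l' l'' : List V} (h : S.Eqv l l') (h' : S.Eqv l' l'') : S.Eqv l l'' :=
  Relation.ReflTransGen.trans h h'

theorem Eqv.cons {l l' : List V} (x : V) (h : S.Eqv l l') : S.Eqv (x :: l) (x :: l') :=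
  Relation.ReflTransGen.lift (x :: ·) (fun _ _ h => Step.cons x h) _ _ h

theorem Eqv.sq {a b c d : V} (l : List V) (h : S.Sq a b c d) :
    S.Eqv (c :: b :: a :: l) (c :: d :: a :: l) :=
  Relation.ReflTransGen.single (Step.sq l h)

theorem Step.length_eq {l l' : List V} (h : S.Step l l') : l.length = l'.length := by
  induction h with
  | cons x _ ih => simp [ih]
  | sq l h => simp

theorem Eqv.length_eq {l l' : List V} (h : S.Eqv l l') : l.length = l'.length := by
  induction h with
  | refl => rfl
  | tail _ h ih => exact ih.trans h.length_eq

theorem Step.exists_cons {x : V} {l m : List V} (h : S.Step (x :: l) m) :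
    ∃ l', m = x :: l' := by
  cases h with
  | cons x h => exact ⟨_, rfl⟩
  | sq l h => exact ⟨_, rfl⟩

theorem Eqv.exists_cons {x : V} {l m : List V} (h : S.Eqv (x :: l) m) :
    ∃ l', m = x :: l' := by
  induction h with
  | refl => exact ⟨_, rfl⟩
  | tail _ h ih =>
    obtain ⟨l', rfl⟩ := ih
    exact h.exists_cons

/-- The last edges of two equivalent paths agree or span a square. -/
theorem Eqv.last_edges (n : ℕ) : ∀ {x y z : V} {P Q : List V}, P.length ≤ n →
    S.Eqv (x :: y :: P) (x :: z :: Q) →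
    (y = z ∧ S.Eqv (y :: P) (z :: Q)) ∨
    ∃ w σ, S.Sq w y x z ∧ S.Eqv (y :: P) (y :: w :: σ) ∧ S.Eqv (z :: Q) (z :: w :: σ) := by
  induction n using Nat.strong_induction_on with
  | _ n IH =>
  intro x y z P Q hn h
  -- Inner induction on the number of pushes. The outer induction on the length is needed when a
  -- push replaces the last vertex but one.
  have main : ∀ R, S.Eqv (x :: y :: P) R → ∀ z Q, R = x :: z :: Q →
      (y = z ∧ S.Eqv (y :: P) (z :: Q)) ∨
      ∃ w σ, S.Sq w y x z ∧ S.Eqv (y :: P) (y :: w :: σ) ∧ S.Eqv (z :: Q) (z :: w :: σ) := by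
    intro R hR
    induction hR with
    | refl =>
      intro z Q hz
      simp only [List.cons.injEq, true_and] at hz
      obtain ⟨rfl, rfl⟩ := hz
      exact Or.inl ⟨rfl, Eqv.rfl⟩
    | @tail R R' hR hs ih =>
      rintro d Q rfl
      cases hs with
      | @cons l _ _ hs =>
        obtain ⟨l', rfl⟩ := hs.symm.exists_cons
        rcases ih d l' rfl with ⟨rfl, h⟩ | ⟨w, σ, hw, h1, h2⟩
        · exact Or.inl ⟨rfl, h.trans (.single hs)⟩
        · exact Or.inr ⟨w, σ, hw, h1, (Eqv.symm (.single hs)).trans h2⟩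
      | @sq a z _ _ l hq =>
        rcases ih z (a :: l) rfl with ⟨rfl, h⟩ | ⟨w, σ, hw, h1, h2⟩
        · exact Or.inr ⟨a, l, hq, h, Eqv.rfl⟩
        · have hlen : l.length < n := by
            have := Eqv.length_eq hR
            simp only [List.length_cons] at this
            omega
          rcases IH l.length hlen le_rfl h2 with ⟨rfl, h3⟩ | ⟨t, τ, ht, h3, h4⟩
          · have : y = d := S.unique (S.rotate (S.rotate hw)) (S.rotate (S.rotate (S.flip hq)))
            subst this
            exact Or.inl ⟨rfl, h1.trans (Eqv.cons y h3.symm)⟩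
          -- Three squares now meet at `z`, with neighbours `x`, `w`, `a`. In the cube they span,
          -- the corner `s` opposite to `z` completes the required square on `y`, `x`, `d`.
          · obtain ⟨s, hs1, hs2, hs3⟩ := S.cube (v := z) (x := x) (y := w) (z := a)
              (p := y) (q := t) (r := d) (S.flip (S.rotate (S.rotate (S.rotate hw))))
              (S.rotate (S.rotate ht)) (S.flip (S.rotate hq))
            refine Or.inr ⟨s, t :: τ, S.rotate (S.rotate (S.flip hs1)), ?_, ?_⟩
            · exact (h1.trans (Eqv.cons y h4)).trans (Eqv.sq τ (S.flip (S.rotate hs2)))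
            · exact (Eqv.cons d h3).trans (Eqv.sq τ (S.rotate (S.rotate (S.rotate hs3))))
  exact main _ h z Q rfl

/-- The path contains a backtrack. -/
inductive HasBacktrack : List V → Prop
  | here (x y : V) (l : List V) : HasBacktrack (x :: y :: x :: l)
  | cons {l : List V} (x : V) : HasBacktrack l → HasBacktrack (x :: l)

variable (S) in
/-- No equivalent path contains a backtrack. -/
def Reduced (l : List V) : Prop := ∀ l', S.Eqv l l' → ¬ HasBacktrack l'

theorem Reduced.congr {l l' : List V} (h : S.Reduced l) (e : S.Eqv l l') : S.Reduced l' :=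
  fun _ h' => h _ (e.trans h')

theorem Reduced.tail {x : V} {l : List V} (h : S.Reduced (x :: l)) : S.Reduced l :=
  fun _ h' hb => h _ (h'.cons x) (hb.cons x)

theorem reduced_singleton (x : V) : S.Reduced [x] := by
  intro l h hb
  have := h.length_eq
  cases hb with
  | here => simp at this
  | cons _ hb => cases hb <;> simp at this

/-- A reduced path that stops being reduced when an edge is appended can be made to end with that
edge. -/
theorem exists_eqv_of_not_reduced (n : ℕ) : ∀ {x y : V} {ρ : List V}, ρ.length ≤ n →
    S.Reduced (x :: ρ) → ¬ S.Reduced (y :: x :: ρ) → ∃ ρ', S.Eqv (x :: ρ) (x :: y :: ρ') := by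
  induction n using Nat.strong_induction_on with
  | _ n IH =>
  intro x y ρ hn hr hnr
  simp only [Reduced, not_forall, not_not] at hnr
  obtain ⟨P, hP, hb⟩ := hnr
  cases hb with
  | here u z α =>
    obtain ⟨_, he⟩ := hP.exists_cons
    simp only [List.cons.injEq] at he
    obtain ⟨rfl, -⟩ := he
    rcases Eqv.last_edges _ le_rfl hP with ⟨rfl, h⟩ | ⟨w, σ, hw, h1, h2⟩
    · exact ⟨_, h⟩
    · rcases Eqv.last_edges _ le_rfl h2 with ⟨rfl, h⟩ | ⟨t, τ, ht, h3, h4⟩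
      · exact absurd rfl (S.ne hw)
      -- The squares at `w, x, y, z` and `t, y, z, w` share the path `y, z, w`, so they coincide,
      -- and the path to `x` would backtrack at `w`.
      · have : t = x := S.unique (S.rotate ht) (S.rotate (S.rotate hw))
        subst this
        exact absurd (HasBacktrack.here _ _ _) (hr _ (h1.trans (h4.cons _)))
  | @cons R u hb =>
    obtain ⟨_, he⟩ := hP.exists_cons
    simp only [List.cons.injEq] at he
    obtain ⟨rfl, -⟩ := he
    obtain ⟨z, Q, rfl⟩ : ∃ z Q, R = z :: Q := by cases hb <;> exact ⟨_, _, rfl⟩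
    rcases Eqv.last_edges _ le_rfl hP with ⟨rfl, h⟩ | ⟨w, σ, hw, h1, h2⟩
    · exact absurd hb (hr _ h)
    · have hσ := (hr.congr h1).tail
      have hlen : σ.length < n := by
        have := h1.length_eq
        simp only [List.length_cons] at this
        omega
      -- The backtrack persists in the path through `w` to `z`, so the shorter path to `w` can be
      -- made to arrive from `z`; pushing across the square then makes the path to `x` arrive from
      -- `y`.
      obtain ⟨σ', h3⟩ := IH _ hlen le_rfl hσ (fun h => h _ h2.symm hb)
      exact ⟨z :: σ', (h1.trans (h3.cons x)).trans
        (Eqv.sq σ' (S.rotate (S.rotate (S.rotate hw))))⟩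

variable (S) in
/-- `l` lists, in reverse order, the vertices before `v` of an edge path from `o` to `v`. -/
inductive Path (o : V) : V → List V → Prop
  | nil : Path o o []
  | cons {x y : V} {l : List V} : Path o x l → S.graph.Adj x y → Path o y (x :: l)

theorem Step.path {o : V} {m m' : List V} (h : S.Step m m') :
    ∀ {v l l'}, m = v :: l → m' = v :: l' → S.Path o v l → S.Path o v l' := by
  induction h with
  | cons x h ih =>
    intro v l l' e e' p
    simp only [List.cons.injEq] at e e'
    obtain ⟨rfl, rfl⟩ := e
    obtain ⟨-, rfl⟩ := e'
    cases p with
    | nil => cases h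
    | cons p a =>
      obtain ⟨l', rfl⟩ := h.exists_cons
      exact .cons (ih rfl rfl p) a
  | sq l h =>
    intro v l l' e e' p
    simp only [List.cons.injEq] at e e'
    obtain ⟨rfl, rfl⟩ := e
    obtain ⟨-, rfl⟩ := e'
    cases p with
    | cons p a =>
      cases p with
      | cons p a' =>
        exact .cons (.cons p (S.adj (S.flip h))) (S.adj (S.rotate (S.flip h)))

theorem Eqv.path {o v : V} {l m : List V} (h : S.Eqv (v :: l) m) (p : S.Path o v l) :
    ∃ l', m = v :: l' ∧ S.Path o v l' := by
  induction h with
  | refl => exact ⟨_, rfl, p⟩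
  | tail _ h ih =>
    obtain ⟨l', rfl, p'⟩ := ih
    obtain ⟨l'', rfl⟩ := h.exists_cons
    exact ⟨_, rfl, h.path (v := v) rfl rfl p'⟩

open Classical in
variable (S) in
/-- Transport of equivalence classes of reduced paths along an edge. -/
noncomputable def transport (x y : V) (c : Set (List V)) : Set (List V) :=
  if ∃ l, x :: y :: l ∈ c then {m | ∃ l, x :: y :: l ∈ c ∧ S.Eqv (y :: l) m}
  else {m | ∃ l ∈ c, S.Eqv (y :: l) m}

/-- Cancelling the last edge is well defined on classes: by `Eqv.last_edges`, equivalent paths with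
the same last edge have equivalent truncations, since a square cannot be degenerate. -/
theorem transport_of_eqv {x y : V} {ρ ρ' : List V} (h : S.Eqv (x :: ρ) (x :: y :: ρ')) :
    S.transport x y {m | S.Eqv (x :: ρ) m} = {m | S.Eqv (y :: ρ') m} := by
  rw [transport, if_pos ⟨ρ', h⟩]
  ext m
  constructor
  · rintro ⟨l, hl, hm⟩
    rcases Eqv.last_edges _ le_rfl (h.symm.trans hl) with ⟨-, h'⟩ | ⟨w, σ, hw, -⟩
    · exact h'.trans hm
    · exact absurd rfl (S.ne (S.rotate hw))
  · intro hm
    exact ⟨ρ', h, hm⟩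

theorem transport_of_not {x y : V} {ρ : List V} (h : ¬ ∃ ρ', S.Eqv (x :: ρ) (x :: y :: ρ')) :
    S.transport x y {m | S.Eqv (x :: ρ) m} = {m | S.Eqv (y :: x :: ρ) m} := by
  rw [transport, if_neg (by exact h)]
  ext m
  constructor
  · rintro ⟨l, hl, hm⟩
    exact (Eqv.cons y hl).trans hm
  · intro hm
    exact ⟨_, Eqv.rfl, hm⟩

theorem class_congr {l l' : List V} (h : S.Eqv l l') : {m | S.Eqv l m} = {m | S.Eqv l' m} := by
  ext m
  exact ⟨fun hm => h.symm.trans hm, fun hm => h.trans hm⟩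

/-- Reduced paths with the same endpoints are equivalent. -/
theorem Reduced.eqv {o v : V} {l l' : List V} (p : S.Path o v l) (p' : S.Path o v l')
    (h : S.Reduced (v :: l)) (h' : S.Reduced (v :: l')) : S.Eqv (v :: l) (v :: l') := by
  -- The fibre over `x` consists of the classes of reduced paths ending at `x`; transport cancels
  -- the edge if possible and appends it otherwise. The section starts at the constant path.
  obtain ⟨φ, hφ, hstep⟩ : ∃ φ : V → Set (List V), φ o = {m | S.Eqv [o] m} ∧
      ∀ x y, S.graph.Adj x y → φ y = S.transport x y (φ x) := by
    refine S.develop (Set (List V)) S.transport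
      (fun x => {c | ∃ ρ, S.Reduced (x :: ρ) ∧ c = {m | S.Eqv (x :: ρ) m}}) ?_ ?_ ?_ o
      {m | S.Eqv [o] m} ⟨[], reduced_singleton o, rfl⟩
    · rintro x y - _ ⟨ρ, hr, rfl⟩
      by_cases h : ∃ ρ', S.Eqv (x :: ρ) (x :: y :: ρ')
      · obtain ⟨ρ', h⟩ := h
        exact ⟨ρ', (hr.congr h).tail, transport_of_eqv h⟩
      · refine ⟨x :: ρ, ?_, transport_of_not h⟩
        by_contra hn
        exact h (exists_eqv_of_not_reduced _ le_rfl hr hn)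
    · rintro x y - _ ⟨ρ, hr, rfl⟩
      by_cases h : ∃ ρ', S.Eqv (x :: ρ) (x :: y :: ρ')
      · obtain ⟨ρ', h⟩ := h
        rw [transport_of_eqv h, transport_of_not, class_congr h]
        rintro ⟨ρ'', h'⟩
        exact hr _ (h.trans (h'.cons x)) (.here _ _ _)
      · rw [transport_of_not h, transport_of_eqv Eqv.rfl]
    · have aux : ∀ a b c d, S.Sq a b c d → ∀ ρ, S.Reduced (a :: ρ) →
          (∃ ρ', S.Eqv (a :: ρ) (a :: b :: ρ')) →
          S.transport b c (S.transport a b {m | S.Eqv (a :: ρ) m}) =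
            S.transport d c (S.transport a d {m | S.Eqv (a :: ρ) m}) := by
        rintro a b c d hq ρ hr ⟨ρ', hb⟩
        by_cases hd : ∃ ρ', S.Eqv (a :: ρ) (a :: d :: ρ')
        · obtain ⟨ρ'', hd⟩ := hd
          rcases Eqv.last_edges _ le_rfl (hb.symm.trans hd) with ⟨rfl, h⟩ | ⟨w, σ, hw, h1, h2⟩
          · exact absurd rfl (S.ne (S.rotate hq))
          · have : w = c := S.unique (S.rotate (S.flip hw)) (S.rotate (S.rotate (S.rotate hq)))
            subst this
            rw [transport_of_eqv hb, transport_of_eqv hd, transport_of_eqv h1, transport_of_eqv h2]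
        · rw [transport_of_eqv hb, transport_of_not hd, transport_of_not]
          · rw [transport_of_eqv]
            exact (hb.cons d).trans (Eqv.sq ρ' (S.rotate (S.rotate (S.rotate (S.flip hq)))))
          · rintro ⟨σ, h⟩
            exact hd ⟨c :: σ, (hb.trans (h.cons a)).trans 
              (Eqv.sq σ (S.rotate (S.rotate (S.flip hq))))⟩
      rintro a b c d hq _ ⟨ρ, hr, rfl⟩
      by_cases hb : ∃ ρ', S.Eqv (a :: ρ) (a :: b :: ρ')
      · exact aux a b c d hq ρ hr hb
      by_cases hd : ∃ ρ', S.Eqv (a :: ρ) (a :: d :: ρ')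
      · exact (aux a d c b (S.flip hq) ρ hr hd).symm
      have aux2 : ∀ b d, S.Sq a b c d → (¬ ∃ ρ', S.Eqv (a :: ρ) (a :: d :: ρ')) →
          ¬ ∃ ρ', S.Eqv (b :: a :: ρ) (b :: c :: ρ') := by
        rintro b d hq hd ⟨ρ', h⟩
        rcases Eqv.last_edges _ le_rfl h with ⟨rfl, h⟩ | ⟨w, σ, hw, h1, h2⟩
        · exact absurd rfl (S.ne hq)
        · have : w = d := S.unique (S.rotate hw) hq
          subst this
          exact hd ⟨σ, h1⟩
      rw [transport_of_not hb, transport_of_not hd, transport_of_not (aux2 b d hq hd),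
        transport_of_not (aux2 d b (S.flip hq) hb)]
      exact class_congr (Eqv.sq ρ hq)
  -- Along a reduced path every transport appends, so the value of the section at the endpoint is
  -- the class of that path. Two reduced paths with the same endpoints thus have the same class.
  have key : ∀ {v l}, S.Path o v l → S.Reduced (v :: l) → φ v = {m | S.Eqv (v :: l) m} := by
    intro v l p
    induction p with
    | nil => exact fun _ => hφ
    | @cons x y l p a ih =>
      intro hr
      rw [hstep x y a, ih hr.tail]
      apply transport_of_not
      rintro ⟨ρ', h⟩
      exact hr _ (h.cons y) (.here _ _ _)
  have := (key p h).symm.trans (key p' h')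
  have hm : v :: l' ∈ {m | S.Eqv (v :: l) m} := by rw [this]; exact Eqv.rfl
  exact hm

theorem Path.dist_le {o v : V} {l : List V} (p : S.Path o v l) : S.graph.dist o v ≤ l.length := by
  induction p with
  | nil => simp
  | @cons x y l p a ih =>
    have h1 := S.connected.dist_triangle (u := o) (v := x) (w := y)
    have h2 : S.graph.dist x y = 1 := SimpleGraph.dist_eq_one_iff_adj.2 a
    simp only [List.length_cons]
    omega

theorem Path.trans {o x v : V} {l m : List V} (p : S.Path o x l) (q : S.Path x v m) :
    S.Path o v (m ++ l) := by
  induction q with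
  | nil => exact p
  | cons _ a ih => exact .cons ih a

theorem exists_path (o v : V) : ∃ l, S.Path o v l ∧ l.length = S.graph.dist o v := by
  have key : ∀ {u v} (w : S.graph.Walk u v), ∃ l, S.Path u v l ∧ l.length = w.length := by
    intro u v w
    induction w with
    | nil => exact ⟨[], .nil, rfl⟩
    | cons a w ih =>
      obtain ⟨l, p, h⟩ := ih
      exact ⟨_, (Path.cons Path.nil a).trans p, by simp [h]⟩
  obtain ⟨w, hw⟩ := S.connected.exists_walk_length_eq_dist o v
  obtain ⟨l, p, h⟩ := key w
  exact ⟨l, p, h.trans hw⟩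

theorem HasBacktrack.exists_shorter {m : List V} (h : HasBacktrack m) :
    ∀ {o v l}, m = v :: l → S.Path o v l → ∃ l', S.Path o v l' ∧ l'.length < l.length := by
  induction h with
  | here x y l =>
    intro o v l e p
    simp only [List.cons.injEq] at e
    obtain ⟨rfl, rfl⟩ := e
    cases p with
    | cons p a =>
      cases p with
      | cons p a' => exact ⟨_, p, by simp only [List.length_cons]; omega⟩
  | cons x h ih =>
    intro o v l e p
    simp only [List.cons.injEq] at e
    obtain ⟨rfl, rfl⟩ := e
    cases p with
    | nil => cases h
    | cons p a =>
      obtain ⟨l', p', hl⟩ := ih rfl p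
      exact ⟨_, .cons p' a, by simpa using hl⟩

theorem Path.reduced {o v : V} {l : List V} (p : S.Path o v l)
    (h : l.length = S.graph.dist o v) : S.Reduced (v :: l) := by
  intro m hm hb
  obtain ⟨l', rfl, p'⟩ := hm.path p
  obtain ⟨l'', p'', hl⟩ := hb.exists_shorter rfl p'
  have h1 := p''.dist_le
  have h2 := hm.length_eq
  simp only [List.length_cons] at h2
  omega

theorem Path.length_eq_of_reduced {o v : V} {l : List V} (p : S.Path o v l)
    (h : S.Reduced (v :: l)) : l.length = S.graph.dist o v := by
  obtain ⟨l', p', hl⟩ := S.exists_path o v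
  have := (Reduced.eqv p p' h (p'.reduced hl)).length_eq
  simp only [List.length_cons] at this
  omega

variable (S) in
/-- The graph is bipartite. -/
theorem dist_ne_of_adj (o : V) {a b : V} (h : S.graph.Adj a b) :
    S.graph.dist o a ≠ S.graph.dist o b := by
  intro he
  obtain ⟨l, p, hl⟩ := S.exists_path o a
  -- If the extended geodesic is reduced, it is a geodesic and `b` is farther away. Otherwise the
  -- geodesic to `a` can be made to arrive from `b`, and `b` is nearer.
  by_cases hr : S.Reduced (b :: a :: l)
  · have := (p.cons h).length_eq_of_reduced hr
    simp only [List.length_cons] at this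
    omega
  · obtain ⟨ρ, hρ⟩ := exists_eqv_of_not_reduced _ le_rfl (p.reduced hl) hr
    obtain ⟨l', e, p'⟩ := hρ.path p
    simp only [List.cons.injEq, true_and] at e
    subst e
    have h2 := hρ.length_eq
    simp only [List.length_cons] at h2
    cases p' with
    | cons p' _ =>
      have := p'.dist_le
      omega

variable (S) in
/-- The quadrangle condition. -/
theorem quadrangle (o : V) {x y z : V} (hy : S.graph.Adj y x) (hz : S.graph.Adj z x) (hyz : y ≠ z)
    (dy : S.graph.dist o y + 1 = S.graph.dist o x) (dz : S.graph.dist o z + 1 = S.graph.dist o x) :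
    ∃ w, S.Sq w y x z ∧ S.graph.dist o w + 1 = S.graph.dist o y := by
  obtain ⟨l, p, hl⟩ := S.exists_path o y
  obtain ⟨m, q, hm⟩ := S.exists_path o z
  have e := Reduced.eqv (p.cons hy) (q.cons hz) ((p.cons hy).reduced (by simp; omega))
    ((q.cons hz).reduced (by simp; omega))
  rcases Eqv.last_edges _ le_rfl e with ⟨h, -⟩ | ⟨w, σ, hw, h1, -⟩
  · exact absurd h hyz
  · refine ⟨w, hw, ?_⟩
    obtain ⟨l', e', p'⟩ := h1.path p
    simp only [List.cons.injEq, true_and] at e'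
    subst e'
    have h2 := h1.length_eq
    simp only [List.length_cons] at h2
    cases p' with
    | cons p' a =>
      have h3 := p'.dist_le
      have h4 := S.connected.dist_triangle (u := o) (v := w) (w := y)
      have h5 : S.graph.dist w y = 1 := SimpleGraph.dist_eq_one_iff_adj.2 a
      omega

end SquareComplex

/-! ### Halfspaces, convexity and medians. -/

namespace SquareComplex

variable {V : Type u} (S : SquareComplex V)

theorem dist_of_adj (o : V) {a b : V} (h : S.graph.Adj a b) :
    S.graph.dist o a = S.graph.dist o b + 1 ∨ S.graph.dist o b = S.graph.dist o a + 1 := by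
  have h1 := S.connected.dist_triangle (u := o) (v := a) (w := b)
  have h2 := S.connected.dist_triangle (u := o) (v := b) (w := a)
  have h3 : S.graph.dist a b = 1 := SimpleGraph.dist_eq_one_iff_adj.2 h
  have h4 : S.graph.dist b a = 1 := SimpleGraph.dist_eq_one_iff_adj.2 h.symm
  have := S.dist_ne_of_adj o h
  omega

theorem dist_pos {x y : V} (h : x ≠ y) : 0 < S.graph.dist x y := S.connected.pos_dist_of_ne h

theorem exists_adj_closer {o x : V} (h : o ≠ x) :
    ∃ y, S.graph.Adj y x ∧ S.graph.dist o y + 1 = S.graph.dist o x := by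
  obtain ⟨l, p, hl⟩ := S.exists_path o x
  cases p with
  | nil => exact absurd rfl h
  | @cons y _ l p a =>
    refine ⟨y, a, ?_⟩
    have := p.dist_le
    have := S.dist_of_adj o a
    simp only [List.length_cons] at hl
    omega

/-- The vertices closer to `a` than to `b`. -/
def half (a b : V) : Set V := {z | S.graph.dist z a < S.graph.dist z b}

/-- The halfspaces of the complex. -/
def halfspaces : Set (Set V) := {Φ | ∃ a b, S.graph.Adj a b ∧ Φ = S.half a b}

variable {S}

theorem left_mem_half {a b : V} (h : S.graph.Adj a b) : a ∈ S.half a b := by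
  simpa [half] using S.dist_pos h.ne

theorem right_notMem_half {a b : V} : b ∉ S.half a b := by
  simp [half]

theorem compl_half {a b : V} (h : S.graph.Adj a b) : (S.half a b)ᶜ = S.half b a := by
  ext z
  have := S.dist_of_adj z h
  simp only [half, Set.mem_compl_iff, Set.mem_ofPred_eq]
  omega

theorem half_mem {a b : V} (h : S.graph.Adj a b) : S.half a b ∈ S.halfspaces := ⟨a, b, h, rfl⟩

theorem compl_mem {Φ : Set V} (h : Φ ∈ S.halfspaces) : Φᶜ ∈ S.halfspaces := by
  obtain ⟨a, b, h, rfl⟩ := h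
  exact ⟨b, a, h.symm, compl_half h⟩

theorem halfspace_nonempty {Φ : Set V} (h : Φ ∈ S.halfspaces) : Φ.Nonempty := by
  obtain ⟨a, b, h, rfl⟩ := h
  exact ⟨a, left_mem_half h⟩

/-- Otherwise parity leaves only one pattern: `a` and `c` are equally far from `z`, and both `b` and
`d` are one step farther. The quadrangle condition at `b` yields a square whose fourth vertex is
nearer than `a`, but by uniqueness that vertex is `d`. -/
theorem half_subset_of_sq {a b c d : V} (h : S.Sq a b c d) : S.half a b ⊆ S.half d c := by
  intro z hz
  have hab := S.adj h
  have hbc := S.adj (S.rotate h)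
  have hcd := S.adj (S.rotate (S.rotate h))
  have had := S.adj (S.flip h)
  have h1 := S.dist_of_adj z hab
  have h2 := S.dist_of_adj z hbc
  have h3 := S.dist_of_adj z hcd
  have h4 := S.dist_of_adj z had
  simp only [half, Set.mem_ofPred_eq] at hz ⊢
  by_contra hn
  obtain ⟨w, hw, hd⟩ := S.quadrangle z hab hbc.symm (S.ne h) (by omega) (by omega)
  have : w = d := S.unique (S.rotate hw) h
  subst this
  omega

theorem half_eq_of_sq {a b c d : V} (h : S.Sq a b c d) : S.half a b = S.half d c :=
  (half_subset_of_sq h).antisymm (half_subset_of_sq (S.rotate (S.flip h)))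

variable (S) in
/-- Oriented parallelism of edges. -/
inductive OPar (a b : V) : V → V → Prop
  | refl : OPar a b a b
  | step {x y x' y' : V} : OPar a b x y → S.Sq x y y' x' → OPar a b x' y'

theorem OPar.half_eq {a b x y : V} (h : S.OPar a b x y) : S.half a b = S.half x y := by
  induction h with
  | refl => rfl
  | step _ hq ih => exact ih.trans (half_eq_of_sq hq)

/-- An edge crossing the boundary can be slid one step towards `a`: a neighbour of `x` closer to `a`
and the vertex `y` are both closer to `b` than `x` is, so the quadrangle condition based at `b`
supplies the square. -/
theorem opar_of_cross {a b : V} (hab : S.graph.Adj a b) (n : ℕ) : ∀ {x y : V},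
    S.graph.dist x a = n → S.graph.Adj x y → x ∈ S.half a b → y ∉ S.half a b →
      S.OPar a b x y := by
  induction n with
  | zero =>
    intro x y hn hxy hx hy
    obtain rfl := S.connected.dist_eq_zero_iff.1 hn
    have h1 := S.dist_of_adj y hab
    have h2 : S.graph.dist y x = 1 := SimpleGraph.dist_eq_one_iff_adj.2 hxy.symm
    simp only [half, Set.mem_ofPred_eq] at hy
    have : S.graph.dist y b = 0 := by omega
    obtain rfl := S.connected.dist_eq_zero_iff.1 this
    exact .refl
  | succ n ih =>
    intro x y hn hxy hx hy
    have e1 := S.dist_of_adj x hab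
    have e2 := S.dist_of_adj y hab
    have e3 := S.dist_of_adj a hxy
    have e4 := S.dist_of_adj b hxy
    obtain ⟨x', hx', hd⟩ := S.exists_adj_closer (o := a) (x := x) (by rintro rfl; simp at hn)
    have e5 := S.dist_of_adj b hx'
    have e6 := S.dist_of_adj x' hab
    simp only [half, Set.mem_ofPred_eq] at hx hy
    simp only [S.graph.dist_comm (u := x), S.graph.dist_comm (u := y),
      S.graph.dist_comm (u := x')] at *
    obtain ⟨w, hw, hdw⟩ := S.quadrangle b hx' hxy.symm (by rintro rfl; omega) (by omega) (by omega)
    have e7 := S.dist_of_adj a (S.adj hw)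
    have e8 := S.dist_of_adj a (S.adj (S.flip hw))
    refine (ih (x := x') (y := w) (by rw [S.graph.dist_comm]; omega) (S.adj hw).symm ?_ ?_).step ?_
    · simp only [half, Set.mem_ofPred_eq]
      simp only [S.graph.dist_comm (u := x')]
      omega
    · simp only [half, Set.mem_ofPred_eq]
      simp only [S.graph.dist_comm (u := w)]
      omega
    · exact S.flip (S.rotate hw)

theorem eq_half {Φ : Set V} (h : Φ ∈ S.halfspaces) {x y : V} (hxy : S.graph.Adj x y)
    (hx : x ∈ Φ) (hy : y ∉ Φ) : Φ = S.half x y := by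
  obtain ⟨a, b, hab, rfl⟩ := h
  exact (opar_of_cross hab _ rfl hxy hx hy).half_eq

theorem opar_of_half_eq {a b x y : V} (hab : S.graph.Adj a b) (hxy : S.graph.Adj x y)
    (h : S.half a b = S.half x y) : S.OPar a b x y :=
  opar_of_cross hab _ rfl hxy (h ▸ left_mem_half hxy) (h ▸ right_notMem_half)

/-- A geodesic that enters a set does so along some edge. -/
theorem exists_cross (Θ : Set V) (n : ℕ) : ∀ {x y : V}, S.graph.dist x y = n → x ∉ Θ → y ∈ Θ →
    ∃ u v, S.graph.Adj u v ∧ u ∉ Θ ∧ v ∈ Θ ∧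
      S.graph.dist x u + 1 + S.graph.dist v y = S.graph.dist x y := by
  induction n with
  | zero =>
    intro x y hn hx hy
    exact absurd (S.connected.dist_eq_zero_iff.1 hn ▸ hy) hx
  | succ n ih =>
    intro x y hn hx hy
    obtain ⟨z, hz, hd⟩ := S.exists_adj_closer (o := x) (x := y) (by rintro rfl; simp at hn)
    by_cases hzΘ : z ∈ Θ
    · obtain ⟨u, v, h1, h2, h3, h4⟩ := ih (x := x) (y := z) (by omega) hx hzΘ
      refine ⟨u, v, h1, h2, h3, ?_⟩
      have e1 := S.connected.dist_triangle (u := v) (v := z) (w := y)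
      have e2 : S.graph.dist z y = 1 := SimpleGraph.dist_eq_one_iff_adj.2 hz
      have e3 := S.connected.dist_triangle (u := x) (v := u) (w := y)
      have e4 := S.connected.dist_triangle (u := u) (v := v) (w := y)
      have e5 : S.graph.dist u v = 1 := SimpleGraph.dist_eq_one_iff_adj.2 h1
      omega
    · exact ⟨z, y, hz, hzΘ, hy, by simp; omega⟩

/-- Halfspaces are convex. -/
theorem halfspace_convex {Φ : Set V} (h : Φ ∈ S.halfspaces) {p m r : V} (hp : p ∈ Φ) (hr : r ∈ Φ)
    (hm : S.graph.dist p m + S.graph.dist m r = S.graph.dist p r) : m ∈ Φ := by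
  by_contra hmΦ
  obtain ⟨u, v, huv, hu, hv, hd⟩ := exists_cross Φ _ rfl hmΦ hr
  have := eq_half h huv.symm hv hu
  rw [this] at hp
  simp only [half, Set.mem_ofPred_eq] at hp
  have e1 := S.connected.dist_triangle (u := p) (v := v) (w := r)
  have e2 := S.connected.dist_triangle (u := p) (v := m) (w := u)
  omega

/-- The median of `p`, `q`, `r` is `p` itself when the intervals from `p` to `q` and to `r` meet
only in `p`. For a first vertex `s` that fails the formula, its predecessor has two neighbours
closer to `q`, and the quadrangle condition produces an earlier failure. -/
theorem dist_add_of_inter {p q r : V}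
    (h : ∀ m, S.graph.dist p m + S.graph.dist m q = S.graph.dist p q →
      S.graph.dist p m + S.graph.dist m r = S.graph.dist p r → m = p) (n : ℕ) :
    ∀ s, S.graph.dist p s = n → S.graph.dist p s + S.graph.dist s r = S.graph.dist p r →
      S.graph.dist q s = S.graph.dist q p + S.graph.dist p s := by
  induction n using Nat.strong_induction_on with
  | _ n IH =>
  intro s hn hs
  by_cases hps : p = s
  · subst hps; simp
  obtain ⟨r', ha, hd⟩ := S.exists_adj_closer hps
  have tri : ∀ {x y}, S.graph.Adj x y → S.graph.dist x r ≤ 1 + S.graph.dist y r := by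
    intro x y hxy
    have := S.connected.dist_triangle (u := x) (v := y) (w := r)
    have e2 : S.graph.dist x y = 1 := SimpleGraph.dist_eq_one_iff_adj.2 hxy
    omega
  have tri' := fun x => S.connected.dist_triangle (u := p) (v := x) (w := r)
  have hr'I : S.graph.dist p r' + S.graph.dist r' r = S.graph.dist p r := by
    have := tri ha
    have := tri' r'
    omega
  have hr' := IH _ (by omega) r' rfl hr'I
  have e := S.dist_of_adj q ha
  rcases e with e | e
  · exfalso
    by_cases hpr : p = r'
    · subst hpr
      refine hps (h s ?_ hs).symm
      have : S.graph.dist p p = 0 := by simp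
      rw [S.graph.dist_comm (u := s), S.graph.dist_comm (u := p) (v := q)]
      omega
    · obtain ⟨r'', ha', hd'⟩ := S.exists_adj_closer hpr
      have hr''I : S.graph.dist p r'' + S.graph.dist r'' r = S.graph.dist p r := by
        have := tri ha'
        have := tri' r''
        omega
      have hr'' := IH _ (by omega) r'' rfl hr''I
      obtain ⟨t, ht, hdt⟩ := S.quadrangle q ha.symm ha' (by rintro rfl; omega) (by omega) (by omega)
      have e1 := S.dist_of_adj p (S.adj ht)
      have e2 := S.dist_of_adj p (S.adj (S.flip ht))
      have htI : S.graph.dist p t + S.graph.dist t r = S.graph.dist p r := by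
        have := tri (S.adj ht)
        have := tri' t
        omega
      have := IH _ (by omega) t rfl htI
      omega
  · omega

variable (S) in
/-- Existence of medians. -/
theorem exists_median (p q r : V) : ∃ m,
    S.graph.dist p m + S.graph.dist m q = S.graph.dist p q ∧
    S.graph.dist p m + S.graph.dist m r = S.graph.dist p r ∧
    S.graph.dist q m + S.graph.dist m r = S.graph.dist q r := by
  induction hn : S.graph.dist p q using Nat.strong_induction_on generalizing p with
  | _ n IH =>
  subst hn
  -- If `p` is not already the median, replace it by another common vertex of the two intervals,
  -- which is closer to `q`.
  by_cases h : ∀ m, S.graph.dist p m + S.graph.dist m q = S.graph.dist p q →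
      S.graph.dist p m + S.graph.dist m r = S.graph.dist p r → m = p
  · exact ⟨p, by simp, by simp, (dist_add_of_inter h _ r rfl (by simp)).symm⟩
  · push Not at h
    obtain ⟨m, h1, h2, hne⟩ := h
    have hpos := S.dist_pos hne.symm
    obtain ⟨m', h3, h4, h5⟩ := IH _ (by omega) m rfl
    have e1 := S.connected.dist_triangle (u := p) (v := m) (w := m')
    have e2 := S.connected.dist_triangle (u := p) (v := m') (w := q)
    have e3 := S.connected.dist_triangle (u := p) (v := m') (w := r)
    exact ⟨m', by omega, by omega, h5⟩

variable (S) in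
/-- Finitely many halfspaces separate two vertices. -/
theorem finite_separating (x y : V) : {Θ ∈ S.halfspaces | x ∈ Θ ∧ y ∉ Θ}.Finite := by
  obtain ⟨p⟩ := S.connected.preconnected x y
  induction p with
  | nil => exact Set.finite_empty.subset fun Θ h => h.2.2 h.2.1
  | @cons x x' y a p ih =>
    refine (ih.insert (S.half x x')).subset ?_
    rintro Θ ⟨h, hx, hy⟩
    by_cases hx' : x' ∈ Θ
    · exact Or.inr ⟨h, hx', hy⟩
    · exact Or.inl (eq_half h a hx hx')

theorem finite_between {Φ Ψ : Set V} (hΦ : Φ.Nonempty) (hΨ : Ψᶜ.Nonempty) :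
    {Θ ∈ S.halfspaces | Φ ⊆ Θ ∧ Θ ⊆ Ψ}.Finite := by
  obtain ⟨x, hx⟩ := hΦ
  obtain ⟨y, hy⟩ := hΨ
  exact (S.finite_separating x y).subset fun Θ h => ⟨h.1, h.2.1 hx, fun hΘ => hy (h.2.2 hΘ)⟩

/-- Transverse halfspaces cross in a square. -/
theorem exists_square_of_transverse {Φ Ψ : Set V} (hΦ : Φ ∈ S.halfspaces) (hΨ : Ψ ∈ S.halfspaces)
    (h : CubeComplex.Transverse Φ Ψ) :
    ∃ x y y' x', S.Sq x y y' x' ∧ Φ = S.half x y ∧ Ψ = S.half x x' := by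
  simp only [CubeComplex.Transverse, CubeComplex.Nested, not_or, Set.not_subset] at h
  obtain ⟨⟨p, hp, hp'⟩, ⟨q, hq, hq'⟩, ⟨r, hr, hr'⟩, ⟨s, hs, hs'⟩⟩ := h
  simp only [Set.mem_compl_iff, not_not] at *
  have key : ∀ {Ψ : Set V} {p q : V}, Ψ ∈ S.halfspaces → p ∈ Φ → p ∈ Ψ → q ∉ Φ → q ∈ Ψ →
      ∃ x y, S.graph.Adj x y ∧ x ∈ Φ ∧ y ∉ Φ ∧ x ∈ Ψ := by
    intro Ψ p q hΨ hp hp' hq hq'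
    obtain ⟨u, v, huv, hu, hv, hd⟩ := exists_cross Φ _ rfl hq hp
    refine ⟨v, u, huv.symm, hv, hu, halfspace_convex hΨ hq' hp' ?_⟩
    have e1 := S.connected.dist_triangle (u := q) (v := u) (w := v)
    have e2 : S.graph.dist u v = 1 := SimpleGraph.dist_eq_one_iff_adj.2 huv
    have e3 := S.connected.dist_triangle (u := q) (v := v) (w := p)
    omega
  obtain ⟨x, y, hxy, hx, hy, hxΨ⟩ := key hΨ hr hr' hs hs'
  obtain ⟨x', y', hxy', hx', hy', hxΨ'⟩ := key (compl_mem hΨ) hp hp' hq hq'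
  have e := eq_half hΦ hxy hx hy
  have ho : S.OPar x y x' y' := opar_of_half_eq hxy hxy' (e.symm.trans (eq_half hΦ hxy' hx' hy'))
  rw [e]
  clear hxy' hx' hy' e
  -- Two edges dual to `Φ` lie on different sides of `Ψ`. Somewhere in the chain of squares joining
  -- them the side changes, and that square is crossed by both hyperplanes.
  induction ho with
  | refl => exact absurd hxΨ hxΨ'
  | @step s t s' t' ho hq ih =>
    by_cases hs : s ∈ Ψ
    · exact ⟨s, t, t', s', hq, ho.half_eq, eq_half hΨ (S.adj (S.flip hq)) hs hxΨ'⟩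
    · exact ih hs

/-- Tightly nested halfspaces osculate. -/
theorem exists_path_of_tight {Φ Ψ : Set V} (hΦ : Φ ∈ S.halfspaces) (hΨ : Ψ ∈ S.halfspaces)
    (h : Φ ⊂ Ψ) (ht : ¬ ∃ Θ ∈ S.halfspaces, Φ ⊂ Θ ∧ Θ ⊂ Ψ) :
    ∃ x y z, S.graph.Adj x y ∧ S.graph.Adj y z ∧ Φ = S.half x y ∧ Ψ = S.half y z := by
  classical
  have hex : ∃ n p q, p ∈ Φ ∧ q ∉ Ψ ∧ S.graph.dist p q = n := by
    obtain ⟨p, hp⟩ := halfspace_nonempty hΦ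
    obtain ⟨q, hq⟩ := halfspace_nonempty (compl_mem hΨ)
    exact ⟨_, p, q, hp, hq, rfl⟩
  -- A closest pair with `p ∈ Φ` and `q ∉ Ψ`. The first edge of a geodesic from `p` to `q` is dual
  -- to `Φ`; if the second is not dual to `Ψ`, its halfspace lies strictly in between.
  obtain ⟨p, q, hp, hq, hpq⟩ := Nat.find_spec hex
  have hmin : ∀ p' q', p' ∈ Φ → q' ∉ Ψ → S.graph.dist p q ≤ S.graph.dist p' q' := by
    intro p' q' hp' hq'
    rw [hpq]
    exact Nat.find_min' hex ⟨p', q', hp', hq', rfl⟩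
  clear hpq
  have hne : q ≠ p := by rintro rfl; exact hq (h.subset hp)
  obtain ⟨y, hyp, hy⟩ := S.exists_adj_closer hne
  have hyΦ : y ∉ Φ := by
    intro hyΦ
    have := hmin y q hyΦ hq
    rw [S.graph.dist_comm (u := p), S.graph.dist_comm (u := y)] at this
    omega
  have hΦe := eq_half hΦ hyp.symm hp hyΦ
  have hyΨ : y ∈ Ψ := by
    by_contra hyΨ
    exact h.ne (hΦe.trans (eq_half hΨ hyp.symm (h.subset hp) hyΨ).symm)
  obtain ⟨z, hzy, hz⟩ := S.exists_adj_closer (o := q) (x := y) (by rintro rfl; exact hq hyΨ)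
  by_cases hzΨ : z ∈ Ψ
  · exfalso
    have hΘ := half_mem hzy.symm
    have hpΘ : p ∈ S.half y z := by
      have e1 := S.connected.dist_triangle (u := p) (v := z) (w := q)
      have e2 : S.graph.dist p y = 1 := SimpleGraph.dist_eq_one_iff_adj.2 hyp.symm
      rw [S.graph.dist_comm (u := z), S.graph.dist_comm (u := p) (v := q)] at e1
      simp only [half, Set.mem_ofPred_eq]
      omega
    have hqΘ : q ∉ S.half y z := by
      simp only [half, Set.mem_ofPred_eq]
      omega
    refine ht ⟨_, hΘ, ⟨?_, fun h' => hyΦ (h' (left_mem_half hzy.symm))⟩,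
      ⟨?_, fun h' => right_notMem_half (h' hzΨ)⟩⟩
    · intro r hr
      by_contra hrΘ
      -- By convexity the median is in `Φ` and outside `S.half y z`, so it differs from `p` and is
      -- closer to `q`, against minimality.
      obtain ⟨m, h1, h2, h3⟩ := S.exists_median p q r
      have hm1 := halfspace_convex hΦ hp hr h2
      have hm2 := halfspace_convex (compl_mem hΘ) hqΘ hrΘ h3
      have := hmin m q hm1 hq
      have hpm : p ≠ m := by rintro rfl; exact hm2 hpΘ
      have := S.dist_pos hpm
      omega
    · intro r hr
      by_contra hrΨ
      obtain ⟨m, h1, h2, h3⟩ := S.exists_median p q r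
      have hm1 := halfspace_convex hΘ hpΘ hr h2
      have hm2 := halfspace_convex (compl_mem hΨ) hq hrΨ h3
      have := hmin p m hp hm2
      have hqm : m ≠ q := by rintro rfl; exact hqΘ hm1
      have := S.dist_pos hqm
      omega
  · exact ⟨p, y, z, hyp.symm, hzy.symm, hΦe, eq_half hΨ hzy.symm hyΨ hzΨ⟩

end SquareComplex

/-! ### Tame actions: shifted halfspaces and their orientation along an axis. -/

theorem smul_ssubset_smul_iff {V G : Type*} [Group G] [MulAction G V] {g : G} {A B : Set V} :
    g • A ⊂ g • B ↔ A ⊂ B := by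
  simp [ssubset_iff_subset_not_subset, Set.smul_set_subset_smul_set_iff]

namespace SquareComplex

variable {V : Type u} (S : SquareComplex V)

/-- Actions by automorphisms such that no halfspace is inverted, is transverse to one of its
translates, or is tightly nested with a disjoint translate. -/
structure TameAction (G : Type*) [Group G] [MulAction G V] : Prop where
  adj : ∀ (g : G) {x y : V}, S.graph.Adj x y → S.graph.Adj (g • x) (g • y)
  no_inversion : ∀ Φ ∈ S.halfspaces, ∀ h : G, h • Φ ≠ Φᶜ
  nested : ∀ Φ ∈ S.halfspaces, ∀ h : G, CubeComplex.Nested Φ (h • Φ)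
  no_osculation : ∀ Φ ∈ S.halfspaces, ∀ h : G, Φ ⊂ (h • Φ)ᶜ →
    ∃ Θ ∈ S.halfspaces, Φ ⊂ Θ ∧ Θ ⊂ (h • Φ)ᶜ

variable {S}
variable {G : Type*} [Group G] [MulAction G V]

theorem dist_smul (hadj : ∀ (g : G) {x y : V}, S.graph.Adj x y → S.graph.Adj (g • x) (g • y))
    (g : G) (x y : V) : S.graph.dist (g • x) (g • y) = S.graph.dist x y := by
  have key : ∀ (g : G) (x y : V), S.graph.dist (g • x) (g • y) ≤ S.graph.dist x y := by
    intro g x y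
    obtain ⟨w, hw⟩ := S.connected.exists_walk_length_eq_dist x y
    let φ : S.graph →g S.graph := ⟨fun x => g • x, fun h => hadj g h⟩
    rw [← hw, ← SimpleGraph.Walk.length_map φ w]
    exact SimpleGraph.dist_le (w.map φ)
  refine (key g x y).antisymm ?_
  simpa using key g⁻¹ (g • x) (g • y)

theorem smul_half (hadj : ∀ (g : G) {x y : V}, S.graph.Adj x y → S.graph.Adj (g • x) (g • y))
    (g : G) (a b : V) : g • S.half a b = S.half (g • a) (g • b) := by
  ext z
  rw [Set.mem_smul_set_iff_inv_smul_mem]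
  simp only [half, Set.mem_ofPred_eq]
  rw [← dist_smul hadj g (g⁻¹ • z) a, ← dist_smul hadj g (g⁻¹ • z) b]
  simp

namespace TameAction

theorem smul_mem (H : S.TameAction G) (g : G) {Φ : Set V} (h : Φ ∈ S.halfspaces) :
    g • Φ ∈ S.halfspaces := by
  obtain ⟨a, b, hab, rfl⟩ := h
  exact ⟨g • a, g • b, H.adj g hab, smul_half H.adj g a b⟩

theorem nested_smul (H : S.TameAction G) {Φ : Set V} (h : Φ ∈ S.halfspaces) (g k : G) :
    CubeComplex.Nested (g • Φ) (k • Φ) := by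
  have := H.nested (g • Φ) (H.smul_mem g h) (k * g⁻¹)
  rwa [smul_smul, inv_mul_cancel_right] at this

/-- An element that fixes a vertex fixes its neighbours. -/
theorem fixes_adj (H : S.TameAction G) {g : G} {v u : V} (hv : g • v = v)
    (h : S.graph.Adj v u) : g • u = u := by
  have hΦ := half_mem h.symm
  have hu := left_mem_half h.symm
  have hvΦ : v ∉ S.half u v := right_notMem_half
  have hg : g • S.half u v = S.half (g • u) v := by rw [smul_half H.adj, hv]
  have hadj : S.graph.Adj (g • u) v := by simpa [hv] using H.adj g h.symm
  have hgΦ := half_mem hadj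
  have hgu := left_mem_half hadj
  have hvg : v ∉ S.half (g • u) v := right_notMem_half
  have fin : S.half u v = S.half (g • u) v → g • u = u := by
    intro e
    rw [← e] at hgu
    have e2 : S.graph.dist (g • u) v = 1 := SimpleGraph.dist_eq_one_iff_adj.2 hadj
    have : S.graph.dist (g • u) u = 0 := by
      simp only [half, Set.mem_ofPred_eq] at hgu
      omega
    exact S.connected.dist_eq_zero_iff.1 this
  have hn := H.nested _ hΦ g
  rw [hg] at hn
  rcases hn with hn | hn | hn | hn
  · exact fin (eq_half hgΦ h.symm (hn hu) hvg).symm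
  · exact absurd (hn hvΦ) hvg
  · by_cases e : S.half u v = (S.half (g • u) v)ᶜ
    · exact absurd hvg (by rw [← Set.mem_compl_iff, ← e]; exact hvΦ)
    -- A halfspace strictly in between would have to be dual to one of the two edges at `v`, and so
    -- equal one of the two ends.
    · obtain ⟨Θ, hΘ, h1, h2⟩ := H.no_osculation _ hΦ g (by rw [hg]; exact hn.ssubset_of_ne e)
      rw [hg] at h2
      by_cases hvΘ : v ∈ Θ
      · have : Θ = S.half v (g • u) := eq_half hΘ hadj.symm hvΘ fun h' => h2.subset h' hgu
        rw [← compl_half hadj] at this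
        exact absurd this h2.ne
      · exact absurd (eq_half hΘ h.symm (h1.subset hu) hvΘ).symm h1.ne
  · exact fin (eq_half hΦ hadj (Set.compl_subset_compl.1 hn hgu) hvΦ)

theorem fixes_all (H : S.TameAction G) {g : G} {v : V} (hv : g • v = v) (x : V) : g • x = x := by
  obtain ⟨p⟩ := S.connected.preconnected v x
  induction p with
  | nil => exact hv
  | cons a _ ih => exact ih (H.fixes_adj hv a)

/-- An element that acts non-trivially shifts some halfspace. -/
theorem exists_shift (H : S.TameAction G) {g : G} (hg : ∃ x : V, g • x ≠ x) :
    ∃ a b, S.graph.Adj a b ∧ g • S.half a b ⊂ S.half a b := by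
  classical
  have hfix : ∀ x : V, g • x ≠ x := by
    intro x hx
    obtain ⟨y, hy⟩ := hg
    exact hy (H.fixes_all hx y)
  have hex : ∃ n, ∃ x : V, S.graph.dist x (g • x) = n := by
    obtain ⟨x, -⟩ := hg
    exact ⟨_, x, rfl⟩
  -- A vertex of minimal displacement; the halfspace is dual to the first edge of a geodesic from
  -- `x` to `g • x`. Minimality places `y` in `g • Φ`.
  obtain ⟨x, hx⟩ := Nat.find_spec hex
  have hmin : ∀ y, S.graph.dist x (g • x) ≤ S.graph.dist y (g • y) := by
    intro y
    rw [hx]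
    exact Nat.find_min' hex ⟨y, rfl⟩
  clear hx
  obtain ⟨y, hyx, hd⟩ := S.exists_adj_closer (hfix x)
  have hgyx := H.adj g hyx
  set Φ := S.half x y with hΦdef
  have hΦ : Φ ∈ S.halfspaces := half_mem hyx.symm
  have hgΦ := H.smul_mem g hΦ
  have egΦ : g • Φ = S.half (g • x) (g • y) := smul_half H.adj g x y
  have hxΦ : x ∈ Φ := left_mem_half hyx.symm
  have hyΦ : y ∉ Φ := right_notMem_half
  have hgx : g • x ∉ Φ := by
    simp only [hΦdef, half, Set.mem_ofPred_eq]
    omega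
  have hgxg : g • x ∈ g • Φ := by rw [egΦ]; exact left_mem_half hgyx.symm
  have hygΦ : y ∈ g • Φ := by
    rw [egΦ]
    have h1 := S.dist_of_adj y hgyx
    have h2 := hmin y
    simp only [half, Set.mem_ofPred_eq]
    rw [S.graph.dist_comm (u := x)] at h2
    rw [S.graph.dist_comm (u := g • x) (v := y)] at hd
    omega
  have hsub : Φ ⊂ g • Φ := by
    rcases H.nested Φ hΦ g with h | h | h | h
    · exact h.ssubset_of_ne fun e => hyΦ (e ▸ hygΦ)
    · exfalso
      have hgy : g • y ∈ Φ := by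
        by_contra hgy
        have := h hgy
        rw [egΦ] at this
        exact right_notMem_half this
      have := eq_half hΦ hgyx hgy hgx
      rw [← compl_half hgyx.symm, ← egΦ] at this
      exact H.no_inversion Φ hΦ g (by conv_rhs => rw [this, compl_compl])
    · exfalso
      have := eq_half hgΦ hyx hygΦ (fun h' => h hxΦ h')
      rw [← compl_half hyx.symm] at this
      exact H.no_inversion Φ hΦ g this
    · exact absurd hygΦ (h hyΦ)
  refine ⟨y, x, hyx, ?_⟩
  rw [← compl_half hyx.symm, Set.smul_set_compl]
  exact compl_lt_compl_iff_lt.2 hsub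

/-- No element exchanges two disjoint translates of a halfspace. -/
theorem no_exchange (H : S.TameAction G) {h : G} (n : ℕ) : ∀ {Φ : Set V}, Φ ∈ S.halfspaces →
    {Θ ∈ S.halfspaces | Φ ⊆ Θ ∧ Θ ⊆ (h • Φ)ᶜ}.ncard = n →
    Φ ⊆ (h • Φ)ᶜ → h • h • Φ = Φ → False := by
  induction n using Nat.strong_induction_on with
  | _ n IH =>
  intro Φ hΦ hn hd hh
  have hne : Φ ≠ (h • Φ)ᶜ := fun e => H.no_inversion Φ hΦ h (by rw [e, compl_compl, ← e])
  have hfin : {Θ ∈ S.halfspaces | Φ ⊆ Θ ∧ Θ ⊆ (h • Φ)ᶜ}.Finite :=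
    finite_between (halfspace_nonempty hΦ)
      (by rw [compl_compl]; exact halfspace_nonempty (H.smul_mem h hΦ))
  obtain ⟨Θ₀, hΘ₀, h1₀, h2₀⟩ := H.no_osculation Φ hΦ h (hd.ssubset_of_ne hne)
  -- For `Θ` minimal above `Φ`, either `h` inverts `Θ`, or `Θ` and `h • Θ` are exchanged as well and
  -- have fewer halfspaces between them.
  obtain ⟨Θ, ⟨hΘ, h1, h2⟩, hmin⟩ : ∃ Θ, Minimal
      (fun Θ => Θ ∈ S.halfspaces ∧ Φ ⊂ Θ ∧ Θ ⊂ (h • Φ)ᶜ) Θ := by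
    have hf : {Θ | Θ ∈ S.halfspaces ∧ Φ ⊂ Θ ∧ Θ ⊂ (h • Φ)ᶜ}.Finite :=
      hfin.subset fun Θ h => ⟨h.1, h.2.1.subset, h.2.2.subset⟩
    exact hf.exists_minimal ⟨Θ₀, hΘ₀, h1₀, h2₀⟩
  have tight : ∀ Ξ ∈ S.halfspaces, Φ ⊂ Ξ → Ξ ⊆ Θ → Ξ = Θ := fun Ξ hΞ h3 h4 =>
    h4.antisymm (hmin ⟨hΞ, h3, h4.trans_ssubset h2⟩ h4)
  obtain ⟨p, hp⟩ := halfspace_nonempty hΦ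
  have hhp : h • p ∈ h • Φ := Set.smul_mem_smul_set hp
  rcases H.nested Θ hΘ h with hc | hc | hc | hc
  · have h3 : h • Θ ⊆ Φᶜ := by
      have := Set.smul_set_subset_smul_set_iff (a := h) |>.2 h2.subset
      rwa [Set.smul_set_compl, hh] at this
    exact h3 (hc (h1.subset hp)) hp
  · have h3 : h • Φ ⊂ Θᶜ := 
      ⟨Set.subset_compl_comm.1 h2.subset, fun h' => h2.not_subset (Set.compl_subset_comm.1 h')⟩
    have h4 : Φ ⊂ h⁻¹ • Θᶜ := by
      rw [← smul_ssubset_smul_iff (g := h), smul_inv_smul]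
      exact h3
    have h5 : h⁻¹ • Θᶜ ⊆ Θ := by
      rwa [← Set.smul_set_subset_smul_set_iff (a := h), smul_inv_smul]
    have h6 := tight _ (H.smul_mem _ (compl_mem hΘ)) h4 h5
    exact H.no_inversion Θ hΘ h (by rw [← h6, smul_inv_smul, h6])
  · have h3 : Θ ⊆ h • h • Θ ∨ h • h • Θ ⊆ Θ := by
      have := H.nested Θ hΘ (h * h)
      rw [mul_smul] at this
      rcases this with h4 | h4 | h4 | h4
      · exact Or.inl h4
      · exfalso
        obtain ⟨q, hq⟩ := halfspace_nonempty (H.smul_mem h hΘ)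
        have h5 : q ∈ Θᶜ := fun h' => hc h' hq
        have h6 := Set.smul_set_subset_smul_set_iff (a := h) |>.2 hc
        rw [Set.smul_set_compl] at h6
        exact h6 hq (h4 h5)
      · exfalso
        refine h4 (h1.subset hp) ?_
        have : h • h • Φ ⊆ h • h • Θ := by
          simpa [Set.smul_set_subset_smul_set_iff] using h1.subset
        rw [hh] at this
        exact this hp
      · exact Or.inr (Set.compl_subset_compl.1 h4)
    have h4 : h • h • Θ = Θ := by
      rcases h3 with h3 | h3
      · have e : (h * h)⁻¹ • Θ = Θ := by
          refine tight _ (H.smul_mem _ hΘ) ?_ ?_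
          · rw [← smul_ssubset_smul_iff (g := h * h), smul_inv_smul, mul_smul, hh]
            exact h1
          · rwa [← Set.smul_set_subset_smul_set_iff (a := h * h), smul_inv_smul, mul_smul]
        rw [smul_smul, ← e, smul_inv_smul, e]
      · refine tight _ (H.smul_mem _ (H.smul_mem _ hΘ)) ?_ h3
        rw [← hh, smul_ssubset_smul_iff, smul_ssubset_smul_iff]
        exact h1
    refine IH _ ?_ hΘ rfl hc h4
    rw [← hn]
    refine Set.ncard_lt_ncard ⟨?_, ?_⟩ hfin
    · rintro Ξ ⟨hΞ, h5, h6⟩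
      refine ⟨hΞ, h1.subset.trans h5, h6.trans (Set.compl_subset_compl.2 ?_)⟩
      exact Set.smul_set_subset_smul_set_iff.2 h1.subset
    · intro h5
      exact h1.not_subset (h5 ⟨hΦ, subset_rfl, hd⟩).2.1
  · exact h2.subset (Set.compl_subset_compl.1 hc (Set.smul_set_mono h1.subset hhp)) hhp

/-- The square of `k` maps the finite interval between `Ψ` and `(k • Ψ)ᶜ` injectively into itself,
hence onto, so its least element `Ψ` is fixed. -/
theorem smul_smul_eq_of_subset (H : S.TameAction G) {Ψ : Set V} (hΨ : Ψ ∈ S.halfspaces) {k : G}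
    (hd : Ψ ⊆ (k • Ψ)ᶜ) (h : Ψ ⊆ k • k • Ψ) : k • k • Ψ = Ψ := by
  set N := {Θ ∈ S.halfspaces | Ψ ⊆ Θ ∧ Θ ⊆ (k • Ψ)ᶜ}
  have hfin : N.Finite := finite_between (halfspace_nonempty hΨ)
    (by rw [compl_compl]; exact halfspace_nonempty (H.smul_mem k hΨ))
  have hinj : Function.Injective fun Θ : Set V => k • k • Θ :=
    (MulAction.injective k).comp (MulAction.injective k)
  have hsub : (fun Θ : Set V => k • k • Θ) '' N ⊆ N := by
    rintro _ ⟨Θ, ⟨h1, h2, h3⟩, rfl⟩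
    refine ⟨H.smul_mem _ (H.smul_mem _ h1), h.trans ?_, ?_⟩
    · exact Set.smul_set_mono (Set.smul_set_mono h2)
    · refine (Set.smul_set_mono (Set.smul_set_mono h3)).trans ?_
      rw [Set.smul_set_compl, Set.smul_set_compl]
      exact Set.compl_subset_compl.2 (Set.smul_set_mono h)
  have heq := Set.eq_of_subset_of_ncard_le hsub (Set.ncard_image_of_injective N hinj).ge hfin
  obtain ⟨Θ, ⟨-, h2, -⟩, h4⟩ : Ψ ∈ (fun Θ : Set V => k • k • Θ) '' N := by
    rw [heq]
    exact ⟨hΨ, subset_rfl, hd⟩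
  refine Set.Subset.antisymm ?_ h
  conv_rhs => rw [← h4]
  exact Set.smul_set_mono (Set.smul_set_mono h2)

/-- An inclusion between `Ψ` and `k • k • Ψ` would be an equality, making `k` exchange `Ψ` and `k •
Ψ`. The two cannot cover everything either, because `k • Ψ` would then lie in the disjoint set `k •
k • Ψ`. -/
theorem disjoint_of_disjoint_smul (H : S.TameAction G) {Ψ : Set V} (hΨ : Ψ ∈ S.halfspaces) {k : G}
    (hd : Ψ ⊆ (k • Ψ)ᶜ) : Ψ ⊆ (k • k • Ψ)ᶜ := by
  have hd' : k • Ψ ⊆ (k • k • Ψ)ᶜ := by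
    rw [← Set.smul_set_compl]; exact Set.smul_set_mono hd
  have no : k • k • Ψ ≠ Ψ := fun e => H.no_exchange _ hΨ rfl hd e
  have := H.nested Ψ hΨ (k * k)
  rw [mul_smul] at this
  rcases this with h | h | h | h
  · exact absurd (H.smul_smul_eq_of_subset hΨ hd h) no
  · exfalso
    obtain ⟨q, hq⟩ := halfspace_nonempty (H.smul_mem k hΨ)
    exact hd' hq (h fun h' => hd h' hq)
  · exact h
  · exfalso
    have h := Set.compl_subset_compl.1 h
    have h1 : Ψ ⊆ k⁻¹ • k⁻¹ • Ψ := by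
      have := Set.smul_set_mono (a := k⁻¹) (Set.smul_set_mono (a := k⁻¹) h)
      simpa using this
    have h2 : Ψ ⊆ (k⁻¹ • Ψ)ᶜ := by
      have := Set.smul_set_mono (a := k⁻¹) (Set.subset_compl_comm.1 hd)
      rw [Set.smul_set_compl] at this
      simpa using this
    have h3 := H.smul_smul_eq_of_subset hΨ h2 h1
    exact no (by conv_lhs => rw [← h3]
                 simp)

/-- Along the axis of `g`, translates of the shifted halfspace `Φ` that are oriented the other way
lie between `Φᶜ` and some `(gⁿΦ)ᶜ`. -/
theorem between_of_reversed (H : S.TameAction G) {g k : G} {a b : V} (hab : S.graph.Adj a b)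
    {n : ℕ} (hn : g ^ n • S.half a b ⊆ S.half a b) (ha : a ∈ k • S.half a b)
    (hga : g ^ n • a ∉ k • S.half a b) :
    (S.half a b)ᶜ ⊆ k • S.half a b ∧ k • S.half a b ⊆ (g ^ n • S.half a b)ᶜ := by
  set Φ := S.half a b with hΦdef
  have hΦ : Φ ∈ S.halfspaces := half_mem hab
  have haΦ : a ∈ Φ := left_mem_half hab
  have hbΦ : b ∉ Φ := right_notMem_half
  have hA := H.smul_mem k hΦ
  have hgaΦ : g ^ n • a ∈ g ^ n • Φ := Set.smul_mem_smul_set haΦ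
  have hgbΦ : g ^ n • b ∉ g ^ n • Φ := by rwa [Set.smul_mem_smul_set_iff]
  have hb : b ∈ k • Φ := by
    by_contra hb
    exact hga ((eq_half hA hab ha hb).symm ▸ hn hgaΦ)
  have hgb : g ^ n • b ∉ k • Φ := by
    intro hgb
    have e := eq_half hA (H.adj (g ^ n) hab.symm) hgb hga
    rw [← compl_half (H.adj (g ^ n) hab), ← smul_half H.adj] at e
    refine H.no_inversion (g ^ n • Φ) (H.smul_mem _ hΦ) (k * (g ^ n)⁻¹) ?_
    rw [smul_smul, inv_mul_cancel_right, e]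
  constructor
  · rcases H.nested Φ hΦ k with h | h | h | h
    · exact absurd (h (hn hgaΦ)) hga
    · exact h
    · exact absurd ha (h haΦ)
    · exact absurd hb (h hbΦ)
  · rcases H.nested_smul hΦ k (g ^ n) with h | h | h | h
    · exact absurd (hn (h hb)) hbΦ
    · exact absurd (h hgb) hgbΦ
    · exact h
    · exact absurd hgaΦ (h hga)

/-- No translate of the pair `Φ ⊃ gΦ` is crossed in the wrong direction by the axis of `g`. -/
theorem no_reversed (H : S.TameAction G) {g h : G} {a b : V} (hab : S.graph.Adj a b)
    (hg : g • S.half a b ⊂ S.half a b) (n : ℕ) (ha : a ∈ h • g • S.half a b) :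
    g ^ n • a ∈ h • S.half a b := by
  classical
  by_contra hga
  set Φ := S.half a b with hΦdef
  have hΦ : Φ ∈ S.halfspaces := half_mem hab
  have anti : ∀ i j : ℕ, i ≤ j → g ^ j • Φ ⊆ g ^ i • Φ := by
    intro i j hij
    induction hij with
    | refl => exact subset_rfl
    | step _ ih =>
      refine subset_trans ?_ ih
      rw [pow_succ, mul_smul]
      exact Set.smul_set_mono hg.subset
  have anti0 : ∀ j : ℕ, g ^ j • Φ ⊆ Φ := fun j => by simpa using anti 0 j (Nat.zero_le j)
  have hBA : h • g • Φ ⊆ h • Φ := Set.smul_set_mono hg.subset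
  obtain ⟨hA1, hA2⟩ := H.between_of_reversed hab (anti0 n) (hBA ha) hga
  obtain ⟨hB1, -⟩ := H.between_of_reversed (k := h * g) hab (anti0 n) (by rwa [mul_smul])
    (by rw [mul_smul]; exact fun h' => hga (hBA h'))
  rw [mul_smul] at hB1
  -- The reversed halfspace `h • Φ` is located between consecutive sets `(g ^ i • Φ)ᶜ` and `(g ^ (i
  -- + 1) • Φ)ᶜ`; translating by `(g ^ i)⁻¹` moves it between `Φᶜ` and `(g • Φ)ᶜ`.
  have hex : ∃ j : ℕ, ¬ (g ^ j • Φ)ᶜ ⊆ h • Φ := by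
    refine ⟨n, fun h' => ?_⟩
    refine H.no_inversion (g ^ n • Φ) (H.smul_mem _ hΦ) (h * (g ^ n)⁻¹) ?_
    rw [smul_smul, inv_mul_cancel_right]
    exact hA2.antisymm h'
  obtain ⟨i, hi⟩ : ∃ i, Nat.find hex = i + 1 := by
    refine Nat.exists_eq_succ_of_ne_zero fun h0 => ?_
    have := Nat.find_spec hex
    rw [h0, pow_zero, one_smul] at this
    exact this hA1
  have hi1 : (g ^ i • Φ)ᶜ ⊆ h • Φ := by
    by_contra h'
    have := Nat.find_min' hex h'
    omega
  have hi2 : ¬ (g ^ (i + 1) • Φ)ᶜ ⊆ h • Φ := hi ▸ Nat.find_spec hex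
  have hi3 : h • Φ ⊆ (g ^ (i + 1) • Φ)ᶜ := by
    rcases H.nested_smul hΦ h (g ^ (i + 1)) with h' | h' | h' | h'
    · obtain ⟨q, hq⟩ := halfspace_nonempty (compl_mem hΦ)
      exact absurd (anti0 _ (h' (hA1 hq))) hq
    · exact absurd (Set.compl_subset_comm.1 h') hi2
    · exact h'
    · exfalso
      obtain ⟨q, hq⟩ := halfspace_nonempty (H.smul_mem (g ^ (n + (i + 1))) hΦ)
      exact h' (fun h'' => hA2 h'' (anti _ _ (Nat.le_add_right _ _) hq))
        (anti _ _ (Nat.le_add_left _ _) hq)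
  set k := (g ^ i)⁻¹ * h with hk
  have hk1 : Φᶜ ⊆ k • Φ := by
    have := Set.smul_set_mono (a := (g ^ i)⁻¹) hi1
    rwa [Set.smul_set_compl, inv_smul_smul, smul_smul] at this
  have hk2 : k • Φ ⊆ (g • Φ)ᶜ := by
    have := Set.smul_set_mono (a := (g ^ i)⁻¹) hi3
    rwa [Set.smul_set_compl, pow_succ, mul_smul, inv_smul_smul, smul_smul] at this
  have hk3 : ((g ^ i)⁻¹ • Φ)ᶜ ⊆ k • g • Φ := by
    have := Set.smul_set_mono (a := (g ^ i)⁻¹) hB1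
    rwa [Set.smul_set_compl, smul_smul (g ^ i)⁻¹ h] at this
  have hdis : Φᶜ ⊆ (k • Φᶜ)ᶜ := by rwa [Set.smul_set_compl, compl_compl]
  -- So `Φᶜ` misses `k • k • Φᶜ`. But the latter contains `k • g • Φ`, which contains the nonempty
  -- subset `((g ^ i)⁻¹ • Φ)ᶜ` of `Φᶜ`.
  have hdis2 := H.disjoint_of_disjoint_smul (compl_mem hΦ) hdis
  have h3 : k • g • Φ ⊆ k • k • Φᶜ := by
    refine Set.smul_set_mono ?_
    rw [Set.smul_set_compl]
    exact Set.subset_compl_comm.1 hk2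
  obtain ⟨q, hq⟩ := halfspace_nonempty (compl_mem (H.smul_mem (g ^ i)⁻¹ hΦ))
  have hq' : q ∈ Φᶜ := by
    intro h'
    refine hq ?_
    have := Set.smul_set_mono (a := (g ^ i)⁻¹) (anti0 i)
    rw [inv_smul_smul] at this
    exact this h'
  exact hdis2 hq' (h3 (hk3 hq))

end TameAction

end SquareComplex

/-! ### The counting function and its defect. -/

section Chains

variable {V : Type u} {G : Type*} [Group G] [MulAction G V]

/-- There are `k` consecutive non-overlapping translates of the pair `Φ ⊇ gΦ` that are entered on
the way from `P` to `Q`, where `P` and `Q` are orientations of the halfspaces. -/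
def HasChain (g : G) (Φ : Set V) (P Q : Set V → Prop) (k : ℕ) : Prop :=
  ∃ h : ℕ → G, (∀ i < k, ¬ P (h i • Φ)) ∧ (∀ i < k, Q (h i • g • Φ)) ∧
    ∀ i, i + 1 < k → h (i + 1) • Φ ⊆ h i • g • Φ

/-- The maximal length of a chain. -/
noncomputable def chainNumber (g : G) (Φ : Set V) (P Q : Set V → Prop) : ℕ :=
  sSup {k | HasChain g Φ P Q k}

/-- At least two of the three points lie in the set. -/
def Majority (x y z : V) (A : Set V) : Prop :=
  (x ∈ A ∧ y ∈ A) ∨ (y ∈ A ∧ z ∈ A) ∨ (z ∈ A ∧ x ∈ A)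

variable {g : G} {Φ : Set V}

theorem hasChain_zero (P Q : Set V → Prop) : HasChain g Φ P Q 0 :=
  ⟨fun _ => 1, by simp, by simp, by simp⟩

theorem HasChain.le_chainNumber {P Q : Set V → Prop} {k : ℕ} (h : HasChain g Φ P Q k)
    (hb : BddAbove {k | HasChain g Φ P Q k}) : k ≤ chainNumber g Φ P Q :=
  le_csSup hb h

theorem hasChain_chainNumber {P Q : Set V → Prop} (hb : BddAbove {k | HasChain g Φ P Q k}) :
    HasChain g Φ P Q (chainNumber g Φ P Q) :=
  Nat.sSup_mem ⟨0, hasChain_zero P Q⟩ hb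

theorem HasChain.smul {x y : V} {k : ℕ} (t : G) (h : HasChain g Φ (x ∈ ·) (y ∈ ·) k) :
    HasChain g Φ (t • x ∈ ·) (t • y ∈ ·) k := by
  obtain ⟨h, h1, h2, h3⟩ := h
  refine ⟨fun i => t * h i, ?_, ?_, ?_⟩
  · intro i hi
    simpa only [mul_smul, Set.smul_mem_smul_set_iff] using h1 i hi
  · intro i hi
    simpa only [mul_smul, Set.smul_mem_smul_set_iff] using h2 i hi
  · intro i hi
    simp only [mul_smul]
    exact Set.smul_set_mono (h3 i hi)

theorem chainNumber_smul (t : G) (x y : V) :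
    chainNumber g Φ (t • x ∈ ·) (t • y ∈ ·) = chainNumber g Φ (x ∈ ·) (y ∈ ·) := by
  unfold chainNumber
  congr 1
  ext k
  refine ⟨fun h => ?_, fun h => HasChain.smul t h⟩
  simpa using HasChain.smul t⁻¹ h

/-- The links `h i • Φ` strictly decrease, so they are distinct translates of `Φ` separating `y`
from `x`. -/
theorem bddAbove_hasChain (hg : g • Φ ⊂ Φ) {x y : V}
    (hfin : {A : Set V | (∃ h : G, A = h • Φ) ∧ y ∈ A ∧ x ∉ A}.Finite) :
    BddAbove {k | HasChain g Φ (x ∈ ·) (y ∈ ·) k} := by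
  refine ⟨{A : Set V | (∃ h : G, A = h • Φ) ∧ y ∈ A ∧ x ∉ A}.ncard, ?_⟩
  rintro k ⟨h, h1, h2, h3⟩
  have hlt : ∀ j, ∀ i < j, j < k → h j • Φ ⊂ h i • Φ := by
    intro j
    induction j with
    | zero => intro i hi; omega
    | succ j ih =>
      intro i hi hj
      have h4 : h (j + 1) • Φ ⊂ h j • Φ :=
        (h3 j hj).trans_ssubset (smul_ssubset_smul_iff.2 hg)
      rcases Nat.lt_succ_iff_lt_or_eq.1 hi with h5 | rfl
      · exact h4.trans (ih i h5 (by omega))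
      · exact h4
  have hinj : Set.InjOn (fun i => h i • Φ) (Finset.range k : Set ℕ) := by
    intro i hi j hj hij
    simp only [Finset.coe_range, Set.mem_Iio] at hi hj
    rcases lt_trichotomy i j with h' | h' | h'
    · exact absurd hij.symm (hlt j i h' hj).ne
    · exact h'
    · exact absurd hij (hlt i j h' hi).ne
  calc k = ((fun i => h i • Φ) '' (Finset.range k : Set ℕ)).ncard := by
        rw [hinj.ncard_image, Set.ncard_coe_finset, Finset.card_range]
    _ ≤ _ := by
        refine Set.ncard_le_ncard ?_ hfin
        rintro _ ⟨i, hi, rfl⟩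
        simp only [Finset.coe_range, Set.mem_Iio] at hi
        exact ⟨⟨h i, rfl⟩, Set.smul_set_mono hg.subset (h2 i hi), h1 i hi⟩

theorem HasChain.of_left {P Q Q' : Set V → Prop} {k : ℕ} (hg : g • Φ ⊆ Φ)
    (hP : ∀ A B, A ⊆ B → P A → P B) (hQ : ∀ A, ¬ P A → Q A → Q' A)
    (h : HasChain g Φ P Q k) : HasChain g Φ P Q' k := by
  obtain ⟨h, h1, h2, h3⟩ := h
  exact ⟨h, h1, fun i hi => hQ _ (fun hp => h1 i hi (hP _ _ (Set.smul_set_mono hg) hp)) (h2 i hi),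
    h3⟩

theorem HasChain.of_right {P P' Q : Set V → Prop} {k : ℕ} (hg : g • Φ ⊆ Φ)
    (hQ : ∀ A B, A ⊆ B → Q A → Q B) (hP : ∀ A, ¬ P A → Q A → ¬ P' A)
    (h : HasChain g Φ P Q k) : HasChain g Φ P' Q k := by
  obtain ⟨h, h1, h2, h3⟩ := h
  exact ⟨h, fun i hi => hP _ (h1 i hi) (hQ _ _ (Set.smul_set_mono hg) (h2 i hi)), h2, h3⟩

theorem HasChain.left_of_majority {x y z : V} {k : ℕ} (hg : g • Φ ⊆ Φ)
    (h : HasChain g Φ (x ∈ ·) (Majority x y z) k) : HasChain g Φ (x ∈ ·) (y ∈ ·) k :=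
  h.of_left hg (fun _ _ h h' => h h') (by unfold Majority; tauto)

theorem HasChain.right_of_majority {x y z : V} {k : ℕ} (hg : g • Φ ⊆ Φ)
    (h : HasChain g Φ (Majority x y z) (y ∈ ·) k) : HasChain g Φ (x ∈ ·) (y ∈ ·) k :=
  h.of_right hg (fun _ _ h h' => h h') (by unfold Majority; tauto)

theorem HasChain.append {x y z : V} {k l : ℕ} (hg : g • Φ ⊆ Φ)
    (hn : ∀ h k : G, CubeComplex.Nested (h • Φ) (k • Φ))
    (h : HasChain g Φ (x ∈ ·) (Majority x y z) k) (h' : HasChain g Φ (Majority x y z) (y ∈ ·) l) :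
    HasChain g Φ (x ∈ ·) (y ∈ ·) (k + l) := by
  obtain ⟨h₁, a1, a2, a3⟩ := h
  obtain ⟨h₂, b1, b2, b3⟩ := h'
  have up : ∀ h : G, h • g • Φ ⊆ h • Φ := fun h => Set.smul_set_mono hg
  refine ⟨fun i => if i < k then h₁ i else h₂ (i - k), ?_, ?_, ?_⟩
  · intro i hi
    by_cases hik : i < k
    · simpa only [hik, if_true] using a1 i hik
    · simp only [hik, if_false]
      have h1 := b1 (i - k) (by omega)
      have h2 := up _ (b2 (i - k) (by omega))
      unfold Majority at h1
      tauto
  · intro i hi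
    by_cases hik : i < k
    · simp only [hik, if_true]
      have h1 := fun h' => a1 i hik (up _ h')
      have h2 := a2 i hik
      unfold Majority at h2
      tauto
    · simpa only [hik, if_false] using b2 (i - k) (by omega)
  · intro i hi
    by_cases hik : i + 1 < k
    · simpa only [hik, (by omega : i < k), if_true] using a3 i hik
    by_cases hik' : i < k
    · have e : i + 1 - k = 0 := by omega
      simp only [hik, hik', if_true, if_false, e]
      have h1 := fun h' => a1 i hik' (up _ h')
      have h2 := a2 i hik'
      have h3 := b1 0 (by omega)
      have h4 := up _ (b2 0 (by omega))
      have h5 := hn (h₁ i * g) (h₂ 0)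
      rw [mul_smul] at h5
      unfold Majority at h2 h3
      -- At the junction the earlier set contains `y`, `z` but not `x`, while the later one contains
      -- `y` but neither `x` nor `z`. Among nested positions only the wanted inclusion remains.
      rcases h5 with h5 | h5 | h5 | h5
      · exact absurd (h5 (show z ∈ _ by tauto)) (by tauto)
      · exact absurd (h5 (show x ∈ _ from h1)) (by tauto)
      · exact absurd h4 (h5 (show y ∈ _ by tauto))
      · exact Set.compl_subset_compl.1 h5
    · have e : i + 1 - k = i - k + 1 := by omega
      simpa only [hik, hik', if_false, e] using b3 (i - k) (by omega)

/-- Cut at the first link whose inner halfspace `M` does not contain. By monotonicity `M` contains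
no later link, so only the link at the cut can be lost. -/
theorem HasChain.split {P Q M : Set V → Prop} {k : ℕ} (hg : g • Φ ⊆ Φ)
    (hM : ∀ A B, A ⊆ B → M A → M B) (h : HasChain g Φ P Q k) :
    ∃ i j, HasChain g Φ P M i ∧ HasChain g Φ M Q j ∧ k ≤ i + j + 1 := by
  classical
  obtain ⟨h, h1, h2, h3⟩ := h
  by_cases hex : ∃ i, i < k ∧ ¬ M (h i • g • Φ)
  · obtain ⟨hi, hiM⟩ := Nat.find_spec hex
    have hmin := fun j (hj : j < Nat.find hex) => Nat.find_min hex hj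
    set i := Nat.find hex
    have hdec : ∀ m, i + 1 + m < k → h (i + 1 + m) • Φ ⊆ h i • g • Φ := by
      intro m
      induction m with
      | zero => intro hm; exact h3 i hm
      | succ m ih =>
        intro hm
        exact ((h3 (i + 1 + m) (by omega)).trans (Set.smul_set_mono hg)).trans (ih (by omega))
    refine ⟨i, k - (i + 1), ⟨h, fun j hj => h1 j (by omega), fun j hj => ?_,
      fun j hj => h3 j (by omega)⟩, ⟨fun m => h (i + 1 + m), fun m hm hM' => ?_,
      fun m hm => h2 _ (by omega), fun m hm => h3 (i + 1 + m) (by omega)⟩, by omega⟩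
    · by_contra hj'
      exact hmin j hj ⟨by omega, hj'⟩
    · exact hiM (hM _ _ (hdec m (by omega)) hM')
  · push Not at hex
    exact ⟨k, 0, ⟨h, h1, hex, h3⟩, hasChain_zero _ _, by omega⟩

theorem majority_mono (x y z : V) (A B : Set V) (h : A ⊆ B) (hA : Majority x y z A) :
    Majority x y z B := by
  rcases hA with ⟨h1, h2⟩ | ⟨h1, h2⟩ | ⟨h1, h2⟩
  · exact Or.inl ⟨h h1, h h2⟩
  · exact Or.inr (Or.inl ⟨h h1, h h2⟩)
  · exact Or.inr (Or.inr ⟨h h1, h h2⟩)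

theorem majority_rotate (x y z : V) : Majority x y z = Majority y z x := by
  ext A
  unfold Majority
  tauto

theorem majority_swap (x y z : V) : Majority x y z = Majority y x z := by
  ext A
  unfold Majority
  tauto

theorem chainNumber_majority (hg : g • Φ ⊆ Φ)
    (hn : ∀ h k : G, CubeComplex.Nested (h • Φ) (k • Φ))
    (hb : ∀ x y : V, BddAbove {k | HasChain g Φ (x ∈ ·) (y ∈ ·) k}) (x y z : V) :
    chainNumber g Φ (x ∈ ·) (Majority x y z) + chainNumber g Φ (Majority x y z) (y ∈ ·) ≤
        chainNumber g Φ (x ∈ ·) (y ∈ ·) ∧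
      chainNumber g Φ (x ∈ ·) (y ∈ ·) ≤ chainNumber g Φ (x ∈ ·) (Majority x y z) +
        chainNumber g Φ (Majority x y z) (y ∈ ·) + 1 := by
  have hb1 : BddAbove {k | HasChain g Φ (x ∈ ·) (Majority x y z) k} :=
    (hb x y).mono fun k hk => HasChain.left_of_majority hg hk
  have hb2 : BddAbove {k | HasChain g Φ (Majority x y z) (y ∈ ·) k} :=
    (hb x y).mono fun k hk => HasChain.right_of_majority hg hk
  constructor
  · exact ((hasChain_chainNumber hb1).append hg hn (hasChain_chainNumber hb2)).le_chainNumber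
      (hb x y)
  · obtain ⟨i, j, hi, hj, hk⟩ := (hasChain_chainNumber (hb x y)).split hg (majority_mono x y z)
    have := hi.le_chainNumber hb1
    have := hj.le_chainNumber hb2
    omega

/-- The counting function of the pair `Φ ⊇ gΦ`. -/
noncomputable def chainCount (g : G) (Φ : Set V) (x y : V) : ℤ :=
  chainNumber g Φ (x ∈ ·) (y ∈ ·) - chainNumber g Φ (y ∈ ·) (x ∈ ·)

/-- All three sides pass through the same majority orientation, so the main terms cancel. Six errors
in {0, 1} remain, three of each sign. -/
theorem abs_chainCount_triangle_le (hg : g • Φ ⊆ Φ)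
    (hn : ∀ h k : G, CubeComplex.Nested (h • Φ) (k • Φ))
    (hb : ∀ x y : V, BddAbove {k | HasChain g Φ (x ∈ ·) (y ∈ ·) k}) (x y z : V) :
    |chainCount g Φ x y + chainCount g Φ y z + chainCount g Φ z x| ≤ 3 := by
  have h1 := chainNumber_majority hg hn hb x y z
  have h2 := chainNumber_majority hg hn hb y z x
  have h3 := chainNumber_majority hg hn hb z x y
  have h4 := chainNumber_majority hg hn hb y x z
  have h5 := chainNumber_majority hg hn hb z y x
  have h6 := chainNumber_majority hg hn hb x z y
  rw [majority_swap y x z] at h4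
  rw [majority_swap z y x, ← majority_rotate x y z] at h5
  rw [majority_swap x z y, majority_rotate z x y] at h6
  rw [← majority_rotate x y z] at h2
  rw [majority_rotate z x y] at h3
  unfold chainCount
  rw [abs_le]
  constructor <;> omega

end Chains

/-! ### Stable commutator length and antisymmetric quasimorphisms. -/

section Scl

variable {G : Type*} [Group G]

theorem inv_mem_commutatorSet {x : G} (h : x ∈ commutatorSet G) : x⁻¹ ∈ commutatorSet G := by
  obtain ⟨a, b, rfl⟩ := h
  exact ⟨b, a, (commutatorElement_inv a b).symm⟩

theorem exists_commutator_list {g : G} (hg : g ∈ commutator G) :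
    ∃ l : List G, (∀ x ∈ l, x ∈ commutatorSet G) ∧ l.prod = g := by
  rw [commutator_eq_closure, ← Subgroup.mem_toSubmonoid, Subgroup.closure_toSubmonoid] at hg
  obtain ⟨l, hl, rfl⟩ := Submonoid.exists_list_of_mem_closure hg
  exact ⟨l, fun x hx => (hl x hx).elim id fun h => inv_inv x ▸ inv_mem_commutatorSet h, rfl⟩

theorem exists_list_length_eq_commutatorLength {g : G} (hg : g ∈ commutator G) :
    ∃ l : List G, l.length = commutatorLength g ∧ (∀ x ∈ l, x ∈ commutatorSet G) ∧ l.prod = g := by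
  obtain ⟨l, h1, h2⟩ := exists_commutator_list hg
  exact Nat.sInf_mem (s := {n | ∃ l : List G, l.length = n ∧ (∀ x ∈ l, x ∈ commutatorSet G) ∧
    l.prod = g}) ⟨_, l, rfl, h1, h2⟩

theorem commutatorLength_mul_le {g h : G} (hg : g ∈ commutator G) (hh : h ∈ commutator G) :
    commutatorLength (g * h) ≤ commutatorLength g + commutatorLength h := by
  obtain ⟨l, h1, h2, h3⟩ := exists_list_length_eq_commutatorLength hg
  obtain ⟨m, k1, k2, k3⟩ := exists_list_length_eq_commutatorLength hh
  refine Nat.sInf_le ⟨l ++ m, by simp [h1, k1], ?_, by simp [h3, k3]⟩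
  intro x hx
  exact (List.mem_append.1 hx).elim (h2 x) (k2 x)

/-- The limit that defines stable commutator length exists. -/
theorem tendsto_scl {g : G} (hg : g ∈ commutator G) :
    Tendsto (fun n : ℕ => (commutatorLength (g ^ n) : ℝ) / n) atTop (𝓝 (scl g)) := by
  have hs : Subadditive fun n : ℕ => (commutatorLength (g ^ n) : ℝ) := by
    intro m n
    simp only [pow_add]
    exact_mod_cast commutatorLength_mul_le (Subgroup.pow_mem _ hg m) (Subgroup.pow_mem _ hg n)
  have ht := hs.tendsto_lim ⟨0, by rintro _ ⟨n, rfl⟩; positivity⟩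
  have : scl g = hs.lim := ht.limUnder_eq
  rwa [this]

/-- An antisymmetric quasimorphism of defect `D` is at most `4D` per commutator. -/
theorem le_of_quasimorphism {f : G → ℤ} {D : ℤ} (hinv : ∀ a, f a⁻¹ = - f a)
    (hq : ∀ a b, |f (a * b) - f a - f b| ≤ D) (l : List G) (hl : ∀ x ∈ l, x ∈ commutatorSet G) :
    f l.prod ≤ 4 * D * l.length := by
  induction l with
  | nil =>
    have := hinv 1
    rw [inv_one] at this
    simp only [List.prod_nil, List.length_nil, Nat.cast_zero, mul_zero]
    omega
  | cons x l ih =>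
    obtain ⟨a, b, rfl⟩ := hl x (by simp)
    have h0 := ih fun x hx => hl x (by simp [hx])
    -- Three products inside the commutator and one with the rest of the list cost `D` each; the
    -- values at `a`, `b` and their inverses cancel.
    have h1 := (abs_le.1 (hq ⁅a, b⁆ l.prod)).2
    have h2 := (abs_le.1 (hq (a * b * a⁻¹) b⁻¹)).2
    have h3 := (abs_le.1 (hq (a * b) a⁻¹)).2
    have h4 := (abs_le.1 (hq a b)).2
    rw [← commutatorElement_def] at h2
    rw [hinv] at h2 h3
    simp only [List.prod_cons, List.length_cons, Nat.cast_add, Nat.cast_one]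
    linarith

theorem sclAtLeast_of_quasimorphism {g : G} (hg : g ∈ commutator G) {f : G → ℤ} {D : ℕ}
    (hD : 0 < D) (hinv : ∀ a, f a⁻¹ = - f a) (hq : ∀ a b, |f (a * b) - f a - f b| ≤ D)
    {C : ℤ} (hf : ∀ n : ℕ, n - C ≤ f (g ^ n)) : SclAtLeast g (1 / (4 * D)) := by
  have ht := tendsto_scl hg
  refine ⟨ht, ?_⟩
  have hlim : Tendsto (fun n : ℕ => (1 - (C : ℝ) * (n : ℝ)⁻¹) * (1 / (4 * D))) atTop
      (𝓝 ((1 - (C : ℝ) * 0) * (1 / (4 * D)))) :=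
    ((tendsto_const_nhds).sub (tendsto_inv_atTop_nhds_zero_nat.const_mul _)).mul_const _
  rw [mul_zero, sub_zero, one_mul] at hlim
  refine le_of_tendsto_of_tendsto hlim ht ?_
  filter_upwards [eventually_gt_atTop 0] with n hn
  obtain ⟨l, h1, h2, h3⟩ := exists_list_length_eq_commutatorLength (Subgroup.pow_mem _ hg n)
  have h4 := (hf n).trans (h3 ▸ le_of_quasimorphism hinv hq l h2)
  rw [h1] at h4
  have h5 : (n : ℝ) - C ≤ 4 * D * commutatorLength (g ^ n) := by exact_mod_cast h4
  have hn' : (0 : ℝ) < n := by exact_mod_cast hn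
  have hD' : (0 : ℝ) < D := by exact_mod_cast hD
  rw [le_div_iff₀ hn']
  calc (1 - (C : ℝ) * (n : ℝ)⁻¹) * (1 / (4 * D)) * n = (n - C) / (4 * D) := by field_simp
    _ ≤ _ := by rw [div_le_iff₀ (by positivity)]; linarith

end Scl

/-! ### The scl bound for tame actions. -/

namespace SquareComplex

variable {V : Type u} {S : SquareComplex V} {G : Type*} [Group G] [MulAction G V]

theorem TameAction.sclAtLeast (H : S.TameAction G) {g : G} (hg : g ∈ commutator G)
    (hne : ∃ x : V, g • x ≠ x) : SclAtLeast g (1 / 24) := by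
  obtain ⟨a, b, hab, hs⟩ := H.exists_shift hne
  set Φ := S.half a b with hΦdef
  have hΦ : Φ ∈ S.halfspaces := half_mem hab
  have hb : ∀ x y : V, BddAbove {k | HasChain g Φ (x ∈ ·) (y ∈ ·) k} := by
    intro x y
    refine bddAbove_hasChain hs ((S.finite_separating y x).subset ?_)
    rintro _ ⟨⟨h, rfl⟩, h1, h2⟩
    exact ⟨H.smul_mem h hΦ, h1, h2⟩
  have hsmul : ∀ (t : G) (x y : V), chainCount g Φ (t • x) (t • y) = chainCount g Φ x y := by
    intro t x y
    simp only [chainCount, chainNumber_smul]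
  have hanti : ∀ x y : V, chainCount g Φ x y = - chainCount g Φ y x := by
    intro x y
    simp [chainCount]
  have key : SclAtLeast g (1 / (4 * (3 : ℕ))) := by
    refine sclAtLeast_of_quasimorphism (f := fun h => chainCount g Φ a (h • a)) hg (by norm_num)
      ?_ ?_ (C := 1) ?_
    · intro h
      rw [← hsmul h a (h⁻¹ • a), smul_inv_smul, hanti]
    · intro h k
      have := abs_chainCount_triangle_le hs.subset (H.nested_smul hΦ) hb a (h • a) ((h * k) • a)
      rw [abs_le] at this ⊢
      have e1 : chainCount g Φ (h • a) ((h * k) • a) = chainCount g Φ a (k • a) := by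
        rw [mul_smul, hsmul]
      have e2 := hanti ((h * k) • a) a
      simp only [Nat.cast_ofNat]
      constructor <;> linarith [this.1, this.2]
    · intro n
      have haΦ : a ∈ Φ := left_mem_half hab
      have hbΦ : b ∉ Φ := right_notMem_half
      have anti : ∀ i : ℕ, g ^ (i + 1) • Φ ⊆ g • Φ := by
        intro i
        induction i with
        | zero => simp
        | succ i ih =>
          refine subset_trans ?_ ih
          rw [pow_succ, mul_smul]
          exact Set.smul_set_mono hs.subset
      have haΦ' : a ∉ g • Φ := fun h =>
        hs.ne (eq_half (H.smul_mem g hΦ) hab h fun h' => hbΦ (hs.subset h'))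
      -- The exponents run from 1 to `n - 1`: `a` already lies in `Φ`, and `g ^ n • a` must lie in
      -- `g ^ (i + 2) • Φ`.
      have h1 : HasChain g Φ (a ∈ ·) (g ^ n • a ∈ ·) (n - 1) := by
        refine ⟨fun i => g ^ (i + 1), fun i _ h => haΦ' (anti i h), fun i hi => ?_, fun i _ => ?_⟩
        · show g ^ n • a ∈ g ^ (i + 1) • g • Φ
          rw [smul_smul, ← pow_succ]
          obtain ⟨m, rfl⟩ : ∃ m, n = i + 1 + 1 + m := ⟨n - (i + 1 + 1), by omega⟩
          rw [pow_add _ (i + 1 + 1), mul_smul, Set.smul_mem_smul_set_iff]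
          cases m with
          | zero => simpa using haΦ
          | succ m =>
            have : g ^ (m + 1) • a ∈ g ^ (m + 1) • Φ := Set.smul_mem_smul_set haΦ
            exact hs.subset (anti m this)
        · rw [smul_smul, ← pow_succ]
      have h2 : chainNumber g Φ (g ^ n • a ∈ ·) (a ∈ ·) = 0 := by
        obtain ⟨h, k1, k2, -⟩ := hasChain_chainNumber (hb (g ^ n • a) a)
        by_contra hpos
        exact k1 0 (Nat.pos_of_ne_zero hpos)
          (H.no_reversed hab hs n (k2 0 (Nat.pos_of_ne_zero hpos)))
      have h3 := h1.le_chainNumber (hb _ _)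
      simp only [chainCount, h2]
      omega
  refine ⟨key.1, le_trans ?_ key.2⟩
  norm_num

end SquareComplex

/-! ### Coordinates on a combinatorial cube. -/

section Flip

variable {n : ℕ}

/-- Change the coordinate `i` of a vertex of the cube. -/
def flipAt (x : Fin n → Bool) (i : Fin n) : Fin n → Bool := Function.update x i (!x i)

theorem flipAt_self (x : Fin n → Bool) (i : Fin n) : flipAt x i i = !x i := by simp [flipAt]

theorem flipAt_of_ne (x : Fin n → Bool) {i j : Fin n} (h : j ≠ i) : flipAt x i j = x j := by
  simp [flipAt, h]

theorem flipAt_ne (x : Fin n → Bool) (i : Fin n) : flipAt x i ≠ x := by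
  intro h
  have := congrFun h i
  rw [flipAt_self] at this
  simp at this

theorem flipAt_comm (x : Fin n → Bool) (i j : Fin n) :
    flipAt (flipAt x i) j = flipAt (flipAt x j) i := by
  by_cases h : i = j
  · rw [h]
  · ext k
    by_cases hi : k = i
    · subst hi
      rw [flipAt_of_ne _ h, flipAt_self, flipAt_self, flipAt_of_ne _ h]
    by_cases hj : k = j
    · subst hj
      rw [flipAt_of_ne _ hi, flipAt_self, flipAt_self, flipAt_of_ne _ hi]
    · rw [flipAt_of_ne _ hi, flipAt_of_ne _ hj, flipAt_of_ne _ hi, flipAt_of_ne _ hj]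

theorem flipAt_flipAt (x : Fin n → Bool) (i : Fin n) : flipAt (flipAt x i) i = x := by
  ext k
  by_cases hi : k = i
  · subst hi
    rw [flipAt_self, flipAt_self, Bool.not_not]
  · rw [flipAt_of_ne _ hi, flipAt_of_ne _ hi]

theorem eq_of_flipAt_eq {x : Fin n → Bool} {i j k l : Fin n} (hij : i ≠ j)
    (h : flipAt (flipAt x i) k = flipAt (flipAt x j) l) (hx : flipAt (flipAt x j) l ≠ x) :
    k = j := by
  by_contra hk
  have h1 := congrFun h j
  rw [flipAt_of_ne _ (Ne.symm hk), flipAt_of_ne _ hij.symm] at h1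
  by_cases hl : l = j
  · subst hl
    exact hx (flipAt_flipAt x l)
  · rw [flipAt_of_ne _ (Ne.symm hl), flipAt_self] at h1
    simp at h1

theorem eq_flipAt_of_forall {x z : Fin n → Bool} {i : Fin n} (h : ∀ k, k ≠ i → z k = x k)
    (hi : z i ≠ x i) : z = flipAt x i := by
  ext k
  by_cases hk : k = i
  · subst hk
    rw [flipAt_self, Bool.eq_not]
    exact hi
  · rw [flipAt_of_ne _ hk, h k hk]

theorem cubeFace_compl_singleton (x : Fin n → Bool) (i : Fin n) :
    cubeFace {i}ᶜ x = {x, flipAt x i} := by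
  ext z
  simp only [cubeFace, Set.mem_compl_iff, Set.mem_singleton_iff, Set.mem_ofPred_eq,
    Set.mem_insert_iff]
  constructor
  · intro h
    by_cases hi : z i = x i
    · refine Or.inl (funext fun k => ?_)
      by_cases hk : k = i
      · rw [hk, hi]
      · exact h k hk
    · exact Or.inr (eq_flipAt_of_forall h hi)
  · rintro (rfl | rfl) k hk
    · rfl
    · exact flipAt_of_ne _ hk

theorem cubeFace_compl_pair (x : Fin n → Bool) (i j : Fin n) :
    cubeFace {i, j}ᶜ x = {x, flipAt x i, flipAt (flipAt x i) j, flipAt x j} := by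
  ext z
  constructor
  · intro h
    simp only [cubeFace, Set.mem_compl_iff, Set.mem_insert_iff, Set.mem_singleton_iff, not_or,
      Set.mem_ofPred_eq] at h
    by_cases hi : z i = x i
    · have : z ∈ cubeFace {j}ᶜ x := by
        intro k hk
        by_cases hk' : k = i
        · rw [hk', hi]
        · exact h k ⟨hk', hk⟩
      rw [cubeFace_compl_singleton] at this
      rcases this with rfl | rfl
      · simp
      · simp
    · have : z ∈ cubeFace {j}ᶜ (flipAt x i) := by
        intro k hk
        by_cases hk' : k = i
        · rw [hk', flipAt_self, Bool.eq_not]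
          exact hi
        · rw [flipAt_of_ne _ hk']
          exact h k ⟨hk', hk⟩
      rw [cubeFace_compl_singleton] at this
      rcases this with rfl | rfl
      · simp
      · simp
  · intro h k hk
    simp only [Set.mem_compl_iff, Set.mem_insert_iff, Set.mem_singleton_iff, not_or] at hk
    rcases h with rfl | rfl | rfl | rfl
    · rfl
    · exact flipAt_of_ne _ hk.1
    · rw [flipAt_of_ne _ hk.2, flipAt_of_ne _ hk.1]
    · exact flipAt_of_ne _ hk.2

end Flip

/-! ### CAT(0) cube complexes as square complexes. -/

namespace CubeComplex

variable {V : Type u} {X : CubeComplex V}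

theorem ncard_ne_three {C : Set V} (hC : C ∈ X.cubes) : C.ncard ≠ 3 := by
  obtain ⟨n, f, hf, rfl, -⟩ := X.exists_param C hC
  rw [← Set.image_univ, Set.ncard_image_of_injective _ hf, Set.ncard_univ]
  simp only [Nat.card_eq_fintype_card, Fintype.card_pi, Fintype.card_bool, Finset.prod_const,
    Finset.card_univ, Fintype.card_fin]
  intro h
  cases n with
  | zero => simp at h
  | succ n => rw [pow_succ] at h; omega

theorem IsSquare.rotate {a b c d : V} (h : X.IsSquare a b c d) : X.IsSquare b c d a where
  adj_ab := h.adj_bc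
  adj_bc := h.adj_cd
  adj_cd := h.adj_da
  adj_da := h.adj_ab
  ne_ac := h.ne_bd
  ne_bd := h.ne_ac.symm
  mem := by
    have e : ({b, c, d, a} : Set V) = {a, b, c, d} := by
      ext; simp only [Set.mem_insert_iff, Set.mem_singleton_iff]; tauto
    rw [e]; exact h.mem

theorem IsSquare.flip {a b c d : V} (h : X.IsSquare a b c d) : X.IsSquare a d c b where
  adj_ab := h.adj_da.symm
  adj_bc := h.adj_cd.symm
  adj_cd := h.adj_bc.symm
  adj_da := h.adj_ab.symm
  ne_ac := h.ne_ac
  ne_bd := h.ne_bd.symm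
  mem := by
    have e : ({a, d, c, b} : Set V) = {a, b, c, d} := by
      ext; simp only [Set.mem_insert_iff, Set.mem_singleton_iff]; tauto
    rw [e]; exact h.mem

/-- Otherwise the cube would meet the square in exactly three vertices, and the number of vertices
of a face is a power of two. -/
theorem IsSquare.mem_of_mem {a b c d : V} (h : X.IsSquare a b c d) {C : Set V} (hC : C ∈ X.cubes)
    (ha : a ∈ C) (hb : b ∈ C) (hd : d ∈ C) : c ∈ C := by
  by_contra hc
  have h1 := X.inter_mem C hC _ h.mem ⟨a, ha, by simp⟩
  have h2 : C ∩ {a, b, c, d} = {a, b, d} := by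
    ext z
    simp only [Set.mem_inter_iff, Set.mem_insert_iff, Set.mem_singleton_iff]
    constructor
    · rintro ⟨hz, rfl | rfl | rfl | rfl⟩
      · simp
      · simp
      · exact absurd hz hc
      · simp
    · rintro (rfl | rfl | rfl) <;> simp [*]
  rw [h2] at h1
  refine ncard_ne_three h1 ?_
  rw [Set.ncard_eq_three]
  exact ⟨a, b, d, h.adj_ab.ne, h.adj_da.ne.symm, h.ne_bd, rfl⟩

theorem IsSquare.unique {a b c d d' : V} (h : X.IsSquare a b c d) (h' : X.IsSquare a b c d') :
    d = d' := by
  have h1 : d ∈ ({a, b, c, d'} : Set V) :=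
    h.rotate.mem_of_mem h'.mem (by simp) (by simp) (by simp)
  simp only [Set.mem_insert_iff, Set.mem_singleton_iff] at h1
  rcases h1 with h1 | h1 | h1 | h1
  · exact absurd h1 h.adj_da.ne
  · exact absurd h1.symm h.ne_bd
  · exact absurd h1.symm h.adj_cd.ne
  · exact h1

section Param

variable {C : Set V} {n : ℕ} {f : (Fin n → Bool) → V}

theorem exists_flipAt_of_adj (hf : Function.Injective f) (hr : Set.range f = C)
    (hfaces : ∀ D ⊆ C, (D ∈ X.cubes ↔ ∃ S a, D = f '' cubeFace S a)) {x : Fin n → Bool} {v : V}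
    (hv : v ∈ C) (h : X.skeleton.Adj (f x) v) : ∃ i, v = f (flipAt x i) := by
  rw [← hr] at hv
  obtain ⟨y, rfl⟩ := hv
  have hsub : ({f x, f y} : Set V) ⊆ C := by
    rw [← hr]
    rintro _ (rfl | rfl) <;> exact ⟨_, rfl⟩
  obtain ⟨T, a, e⟩ := (hfaces _ hsub).1 h.2
  have hxy : x ≠ y := fun e => h.1 (congrArg f e)
  have mem : ∀ z, z ∈ cubeFace T a ↔ z = x ∨ z = y := by
    intro z
    rw [← hf.mem_set_image, ← e]
    simp [hf.eq_iff]
  have hx := (mem x).2 (Or.inl rfl)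
  have hy := (mem y).2 (Or.inr rfl)
  obtain ⟨i, hi⟩ := Function.ne_iff.1 hxy
  refine ⟨i, ?_⟩
  have hz : flipAt x i ∈ cubeFace T a := by
    intro k hk
    rw [flipAt_of_ne, hx k hk]
    rintro rfl
    exact hi ((hx k hk).trans (hy k hk).symm)
  rcases (mem _).1 hz with h' | h'
  · exact absurd h' (flipAt_ne x i)
  · rw [h']

theorem adj_flipAt (hf : Function.Injective f) (hr : Set.range f = C)
    (hfaces : ∀ D ⊆ C, (D ∈ X.cubes ↔ ∃ S a, D = f '' cubeFace S a)) (x : Fin n → Bool)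
    (i : Fin n) : X.skeleton.Adj (f x) (f (flipAt x i)) := by
  refine ⟨fun e => flipAt_ne x i (hf e).symm, ?_⟩
  have e : ({f x, f (flipAt x i)} : Set V) = f '' cubeFace {i}ᶜ x := by
    rw [cubeFace_compl_singleton, Set.image_pair]
  rw [hfaces]
  · exact ⟨_, _, e⟩
  · rw [e, ← hr]
    exact Set.image_subset_range _ _

theorem isSquare_flipAt (hf : Function.Injective f) (hr : Set.range f = C)
    (hfaces : ∀ D ⊆ C, (D ∈ X.cubes ↔ ∃ S a, D = f '' cubeFace S a)) (x : Fin n → Bool)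
    {i j : Fin n} (hij : i ≠ j) :
    X.IsSquare (f x) (f (flipAt x i)) (f (flipAt (flipAt x i) j)) (f (flipAt x j)) where
  adj_ab := adj_flipAt hf hr hfaces x i
  adj_bc := adj_flipAt hf hr hfaces _ j
  adj_cd := by
    rw [flipAt_comm]
    exact (adj_flipAt hf hr hfaces _ i).symm
  adj_da := (adj_flipAt hf hr hfaces x j).symm
  ne_ac := by
    intro e
    have := congrFun (hf e) i
    rw [flipAt_of_ne _ hij, flipAt_self] at this
    simp at this
  ne_bd := by
    intro e
    have := congrFun (hf e) i
    rw [flipAt_of_ne _ hij, flipAt_self] at this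
    simp at this
  mem := by
    have e : ({f x, f (flipAt x i), f (flipAt (flipAt x i) j), f (flipAt x j)} : Set V) =
        f '' cubeFace {i, j}ᶜ x := by
      rw [cubeFace_compl_pair x i j]
      simp only [Set.image_insert_eq, Set.image_singleton]
    rw [hfaces]
    · exact ⟨_, _, e⟩
    · rw [e, ← hr]
      exact Set.image_subset_range _ _

end Param

/-- Flagness puts the three edges at `v` into one cube, which then contains the three squares; in
its coordinates `s` is obtained by flipping all three directions. -/
theorem exists_cube_of_squares (hX : X.HasFlagLinks) {v x y z p q r : V}
    (h₁ : X.IsSquare v x p y) (h₂ : X.IsSquare v y q z) (h₃ : X.IsSquare v z r x) :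
    ∃ s, X.IsSquare x p s r ∧ X.IsSquare y q s p ∧ X.IsSquare z r s q := by
  obtain ⟨C, hC, hv, hS⟩ := hX v {x, y, z} (by simp)
    (by rintro u (rfl | rfl | rfl)
        exacts [h₁.adj_ab, h₂.adj_ab, h₃.adj_ab])
    (by
      rintro u (rfl | rfl | rfl) u' (rfl | rfl | rfl) hne
      · exact absurd rfl hne
      · exact ⟨_, h₁.mem, by simp, by simp, by simp⟩
      · exact ⟨_, h₃.mem, by simp, by simp, by simp⟩
      · exact ⟨_, h₁.mem, by simp, by simp, by simp⟩
      · exact absurd rfl hne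
      · exact ⟨_, h₂.mem, by simp, by simp, by simp⟩
      · exact ⟨_, h₃.mem, by simp, by simp, by simp⟩
      · exact ⟨_, h₂.mem, by simp, by simp, by simp⟩
      · exact absurd rfl hne)
  have hx : x ∈ C := hS (by simp)
  have hy : y ∈ C := hS (by simp)
  have hz : z ∈ C := hS (by simp)
  have hp := h₁.mem_of_mem hC hv hx hy
  have hq := h₂.mem_of_mem hC hv hy hz
  have hr := h₃.mem_of_mem hC hv hz hx
  obtain ⟨n, f, hf, hrange, hfaces⟩ := X.exists_param C hC
  obtain ⟨o, rfl⟩ : ∃ o, f o = v := by rw [← hrange] at hv; exact hv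
  obtain ⟨i, rfl⟩ := exists_flipAt_of_adj hf hrange hfaces hx h₁.adj_ab
  obtain ⟨j, rfl⟩ := exists_flipAt_of_adj hf hrange hfaces hy h₂.adj_ab
  obtain ⟨k, rfl⟩ := exists_flipAt_of_adj hf hrange hfaces hz h₃.adj_ab
  have corner : ∀ {i j : Fin n} {p : V}, p ∈ C →
      X.IsSquare (f o) (f (flipAt o i)) p (f (flipAt o j)) →
        i ≠ j ∧ p = f (flipAt (flipAt o i) j) := by
    intro i j p hp h
    have hij : i ≠ j := fun e => h.ne_bd (by rw [e])
    obtain ⟨l, rfl⟩ := exists_flipAt_of_adj hf hrange hfaces hp h.adj_bc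
    obtain ⟨m, hm⟩ := exists_flipAt_of_adj hf hrange hfaces hp h.adj_cd.symm
    have hm' := hf hm
    have := eq_of_flipAt_eq hij hm' (by
      rw [← hm']
      exact fun e => h.ne_ac (by rw [e]))
    rw [this]
    exact ⟨hij, rfl⟩
  obtain ⟨hij, rfl⟩ := corner hp h₁
  obtain ⟨hjk, rfl⟩ := corner hq h₂
  obtain ⟨hki, rfl⟩ := corner hr h₃
  refine ⟨f (flipAt (flipAt (flipAt o i) j) k), ?_, ?_, ?_⟩
  · have := isSquare_flipAt hf hrange hfaces (flipAt o i) hjk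
    rwa [flipAt_comm o k i]
  · have := isSquare_flipAt hf hrange hfaces (flipAt o j) hki
    rwa [flipAt_comm (flipAt o j) k i, flipAt_comm o j i] at this
  · have := isSquare_flipAt hf hrange hfaces (flipAt o k) hij
    rwa [flipAt_comm (flipAt o k) i j, flipAt_comm o k j, flipAt_comm (flipAt o j) k i,
      flipAt_comm o j i] at this

section Develop

variable {T : Type*} (act : V → V → T → T)

/-- Transport along an edge path. -/
def run : ∀ {u v : V}, X.skeleton.Walk u v → T → T
  | _, _, .nil, t => t
  | _, _, .cons (u := u) (v := v) _ p, t => run p (act u v t)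

variable {act}

theorem run_append {u v w : V} (p : X.skeleton.Walk u v) (q : X.skeleton.Walk v w) (t : T) :
    run act (p.append q) t = run act q (run act p t) := by
  induction p generalizing t with
  | nil => rfl
  | cons a p ih => exact ih q _

variable {I : V → Set T}

theorem run_mem (h₁ : ∀ x y, X.skeleton.Adj x y → ∀ t ∈ I x, act x y t ∈ I y) {u v : V}
    (p : X.skeleton.Walk u v) {t : T} (ht : t ∈ I u) : run act p t ∈ I v := by
  induction p generalizing t with
  | nil => exact ht
  | cons a p ih => exact ih (h₁ _ _ a _ ht)

theorem Homotopic.run_eq (h₁ : ∀ x y, X.skeleton.Adj x y → ∀ t ∈ I x, act x y t ∈ I y)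
    (h₂ : ∀ x y, X.skeleton.Adj x y → ∀ t ∈ I x, act y x (act x y t) = t)
    (h₃ : ∀ a b c d, X.IsSquare a b c d → ∀ t ∈ I a, act b c (act a b t) = act d c (act a d t))
    {u v : V} {p q : X.skeleton.Walk u v} (h : X.Homotopic p q) :
    ∀ t ∈ I u, run act p t = run act q t := by
  induction h with
  | refl p => exact fun _ _ => rfl
  | symm _ ih => exact fun t ht => (ih t ht).symm
  | trans _ _ ih ih' => exact fun t ht => (ih t ht).trans (ih' t ht)
  | append _ _ ih ih' =>
    intro t ht
    rw [run_append, run_append, ih t ht]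
    exact ih' _ (run_mem h₁ _ ht)
  | backtrack h => exact fun t ht => h₂ _ _ h t ht
  | square h => exact fun t ht => h₃ _ _ _ _ h t ht

/-- Transport `t` along a chosen path to each vertex. Loops act trivially because they are
null-homotopic, so the choice of path does not matter. -/
theorem exists_section (hX : X.IsSimplyConnected)
    (h₁ : ∀ x y, X.skeleton.Adj x y → ∀ t ∈ I x, act x y t ∈ I y)
    (h₂ : ∀ x y, X.skeleton.Adj x y → ∀ t ∈ I x, act y x (act x y t) = t)
    (h₃ : ∀ a b c d, X.IsSquare a b c d → ∀ t ∈ I a, act b c (act a b t) = act d c (act a d t))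
    (u : V) (t : T) (ht : t ∈ I u) :
    ∃ φ : V → T, φ u = t ∧ ∀ x y, X.skeleton.Adj x y → φ y = act x y (φ x) := by
  have loop : ∀ {v : V} (p : X.skeleton.Walk v v) {t : T}, t ∈ I v → run act p t = t :=
    fun p t ht => (hX.2 _ p).run_eq h₁ h₂ h₃ t ht
  let walk : ∀ x, X.skeleton.Walk u x := fun x => (hX.1.preconnected u x).some
  refine ⟨fun x => run act (walk x) t, loop _ ht, fun x y h => ?_⟩
  set s := act x y (run act (walk x) t) with hs
  have hsI : s ∈ I y := h₁ _ _ h _ (run_mem h₁ _ ht)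
  have e1 := loop ((walk y).reverse.append (walk y)) hsI
  have e2 := loop ((walk x).append ((SimpleGraph.Walk.cons h .nil).append (walk y).reverse)) ht
  rw [run_append, run_append] at e2
  rw [run_append] at e1
  change run act (walk y).reverse s = t at e2
  rwa [e2] at e1

end Develop

variable (X) in
/-- The square complex underlying a CAT(0) cube complex. -/
def toSquareComplex (hX : X.IsCAT0) : SquareComplex V where
  graph := X.skeleton
  Sq := X.IsSquare
  connected := hX.simplyConnected.1
  adj h := h.adj_ab
  ne h := h.ne_ac
  rotate h := h.rotate
  flip h := h.flip
  unique h h' := h.unique h'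
  cube h₁ h₂ h₃ := exists_cube_of_squares hX.flag h₁ h₂ h₃
  develop _ _ _ h₁ h₂ h₃ := exists_section hX.simplyConnected h₁ h₂ h₃

variable (hX : X.IsCAT0)

theorem Parallel.half_mem_iff {e e' : Sym2 V} (h : X.Parallel e e') (Φ : Set V) :
    (∃ a b, e = s(a, b) ∧ Φ = (X.toSquareComplex hX).half a b) ↔
      ∃ a b, e' = s(a, b) ∧ Φ = (X.toSquareComplex hX).half a b := by
  induction h with
  | rel e e' h =>
    obtain ⟨a, b, c, d, hq, rfl, rfl⟩ := h
    have e1 : (X.toSquareComplex hX).half a b = (X.toSquareComplex hX).half d c :=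
      SquareComplex.half_eq_of_sq hq
    have e2 : (X.toSquareComplex hX).half b a = (X.toSquareComplex hX).half c d :=
      SquareComplex.half_eq_of_sq (S := X.toSquareComplex hX) hq.rotate.flip
    simp only [Sym2.eq_iff]
    constructor
    · rintro ⟨x, y, ⟨rfl, rfl⟩ | ⟨rfl, rfl⟩, rfl⟩
      · exact ⟨d, c, by simp, e1⟩
      · exact ⟨c, d, by simp, e2⟩
    · rintro ⟨x, y, ⟨rfl, rfl⟩ | ⟨rfl, rfl⟩, rfl⟩
      · exact ⟨a, b, by simp, e1.symm⟩
      · exact ⟨b, a, by simp, e2.symm⟩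
  | refl => rfl
  | symm _ _ _ ih => exact ih.symm
  | trans _ _ _ _ _ ih ih' => exact ih.trans ih'

theorem parallel_of_opar {a b x y : V} (h : (X.toSquareComplex hX).OPar a b x y) :
    X.Parallel s(a, b) s(x, y) := by
  induction h with
  | refl => exact Relation.EqvGen.refl _
  | step _ hq ih => exact ih.trans _ _ _ (Relation.EqvGen.rel _ _ ⟨_, _, _, _, hq, rfl, rfl⟩)

/-- Leaving the halfspace means crossing a parallel edge. Conversely, a geodesic from `a` stays
inside the halfspace, and by `Parallel.half_mem_iff` none of its edges is parallel to `ab`. -/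
theorem side_eq_half {a b : V} (hab : X.skeleton.Adj a b) :
    X.side a b = (X.toSquareComplex hX).half a b := by
  set S := X.toSquareComplex hX
  apply Set.Subset.antisymm
  · rintro x ⟨p⟩
    have key : ∀ {u v : V}, (X.skeleton.deleteEdges {e | X.Parallel s(a, b) e}).Walk u v →
        u ∈ S.half a b → v ∈ S.half a b := by
      intro u v p
      induction p with
      | nil => exact id
      | @cons u v w h p ih =>
        intro hu
        apply ih
        by_contra hv
        rw [SimpleGraph.deleteEdges_adj] at h
        exact h.2 (parallel_of_opar hX (SquareComplex.opar_of_cross hab _ rfl h.1 hu hv))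
    exact key p (SquareComplex.left_mem_half hab)
  · have key : ∀ n, ∀ x ∈ S.half a b, S.graph.dist a x = n → x ∈ X.side a b := by
      intro n
      induction n with
      | zero =>
        intro x _ hn
        rw [S.connected.dist_eq_zero_iff] at hn
        subst hn
        exact SimpleGraph.Reachable.refl _
      | succ n ih =>
        intro x hx hn
        obtain ⟨x', hadj, hd⟩ := S.exists_adj_closer (o := a) (x := x) (by rintro rfl; simp at hn)
        have hx' : x' ∈ S.half a b := by
          have e1 := S.dist_of_adj b hadj
          simp only [SquareComplex.half, Set.mem_ofPred_eq] at hx ⊢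
          rw [S.graph.dist_comm (u := x), S.graph.dist_comm (u := x) (v := b)] at hx
          rw [S.graph.dist_comm (u := x'), S.graph.dist_comm (u := x') (v := b)]
          omega
        have hside : x' ∈ X.side a b := ih x' hx' (by omega)
        refine SimpleGraph.Reachable.trans hside (SimpleGraph.Adj.reachable ?_)
        rw [SimpleGraph.deleteEdges_adj]
        refine ⟨hadj, fun hp => ?_⟩
        obtain ⟨c, d, hcd, e⟩ := (hp.half_mem_iff hX (S.half x' x)).2 ⟨x', x, rfl, rfl⟩
        rw [Sym2.eq_iff] at hcd
        rcases hcd with ⟨rfl, rfl⟩ | ⟨rfl, rfl⟩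
        · rw [← show S.half x' x = S.half a b from e] at hx
          exact SquareComplex.right_notMem_half hx
        · have h1 := SquareComplex.left_mem_half hadj
          rw [show S.half x' x = S.half b a from e, ← SquareComplex.compl_half hab] at h1
          exact h1 hx'
    exact fun x hx => key _ x hx rfl

theorem halfspaces_eq : X.halfspaces = (X.toSquareComplex hX).halfspaces := by
  ext Φ
  constructor
  · rintro ⟨a, b, h, rfl⟩
    exact ⟨a, b, h, side_eq_half hX h⟩
  · rintro ⟨a, b, h, rfl⟩
    exact ⟨a, b, h, (side_eq_half hX h).symm⟩

theorem IsRAAGLikeAction.tameAction {G : Type*} [Group G] [MulAction G V]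
    (H : X.IsRAAGLikeAction G) : (X.toSquareComplex hX).TameAction G where
  adj g x y h := by
    refine ⟨fun e => h.1 (MulAction.injective g e), ?_⟩
    have := H.isAction g _ h.2
    rwa [Set.smul_set_insert, Set.smul_set_singleton] at this
  no_inversion Φ hΦ h e := by
    rw [← halfspaces_eq] at hΦ
    exact H.no_inversion ⟨Φ, hΦ, h⁻¹, by rw [← e, inv_smul_smul]⟩
  nested Φ hΦ h := by
    rw [← halfspaces_eq] at hΦ
    by_contra hn
    exact H.nonTransverse ⟨Φ, hΦ, h, hn⟩
  no_osculation Φ hΦ h hlt := by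
    obtain ⟨x, hx⟩ := SquareComplex.halfspace_nonempty hΦ
    have hsmul : (h • Φ).Nonempty := ⟨h • x, Set.smul_mem_smul_set hx⟩
    rw [← halfspaces_eq] at hΦ ⊢
    by_contra hn
    refine H.no_selfosculation ⟨Φ, hΦ, h, ?_, ?_⟩
    · rw [Set.smul_set_compl]
      exact hlt.subset
    · rw [Set.smul_set_compl]
      refine ⟨hlt.ne, Or.inl hlt.subset, ?_⟩
      -- For disjoint nonempty halfspaces only the first choice of orientations is consistent; the
      -- other three are contradictory.
      rintro ⟨Θ, hΘ, ⟨h1, h2⟩ | ⟨h1, h2⟩ | ⟨h1, h2⟩ | ⟨h1, h2⟩⟩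
      · exact hn ⟨Θ, hΘ, h1, h2⟩
      · obtain ⟨y, hy⟩ := hsmul
        by_cases hyΦ : y ∈ Φ
        · exact hlt.subset hyΦ hy
        · exact h2.subset (h1.subset hyΦ) hy
      · exact h2.subset (h1.subset hx) (hlt.subset hx)
      · exact hlt.not_subset (Set.compl_subset_compl.1 (h1.subset.trans h2.subset))

end CubeComplex

/-! ### Cayley complexes of right-angled Artin groups. -/

namespace RAAG

variable {W : Type w} (Γ : SimpleGraph W)

/-- The generator of a right-angled Artin group that belongs to a vertex. -/
def gen (a : W) : RAAG Γ := PresentedGroup.of a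

/-- `s` is the generator `a` or its inverse. -/
def IsLetter (a : W) (s : RAAG Γ) : Prop := s = gen Γ a ∨ s = (gen Γ a)⁻¹

variable {Γ}

theorem IsLetter.inv {a : W} {s : RAAG Γ} (h : IsLetter Γ a s) : IsLetter Γ a s⁻¹ := by
  rcases h with rfl | rfl
  · exact Or.inr rfl
  · exact Or.inl (inv_inv _)

theorem commute_gen {a b : W} (h : Γ.Adj a b) : Commute (gen Γ a) (gen Γ b) := by
  rw [← commutatorElement_eq_one_iff_commute]
  exact PresentedGroup.one_of_mem ⟨a, b, h, rfl⟩

theorem IsLetter.commute {a b : W} {s t : RAAG Γ} (hs : IsLetter Γ a s) (ht : IsLetter Γ b t)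
    (h : Γ.Adj a b) : s * t = t * s := by
  have := commute_gen h
  rcases hs with rfl | rfl <;> rcases ht with rfl | rfl
  · exact this
  · exact this.inv_right
  · exact this.inv_left
  · exact this.inv_inv

/-- The universal property. -/
noncomputable def lift {H : Type*} [Group H] (f : W → H)
    (hf : ∀ a b, Γ.Adj a b → Commute (f a) (f b)) : RAAG Γ →* H :=
  PresentedGroup.toGroup (f := f) (by
    rintro _ ⟨a, b, h, rfl⟩
    rw [map_commutatorElement, FreeGroup.lift_apply_of, FreeGroup.lift_apply_of]
    exact commutatorElement_eq_one_iff_commute.2 (hf a b h))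

theorem lift_gen {H : Type*} [Group H] (f : W → H)
    (hf : ∀ a b, Γ.Adj a b → Commute (f a) (f b)) (a : W) : lift f hf (gen Γ a) = f a :=
  PresentedGroup.toGroup.of _

open Classical in
/-- The exponent sum of a generator. -/
noncomputable def exponent (a : W) : RAAG Γ →* Multiplicative ℤ :=
  lift (fun b => if b = a then Multiplicative.ofAdd 1 else 1) (fun _ _ _ => Commute.all _ _)

theorem exponent_self_ne {a : W} {s : RAAG Γ} (h : IsLetter Γ a s) : exponent a s ≠ 1 := by
  rcases h with rfl | rfl
  · rw [exponent, lift_gen, if_pos rfl]; decide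
  · rw [map_inv, exponent, lift_gen, if_pos rfl]; decide

theorem exponent_of_ne {a b : W} {s : RAAG Γ} (h : IsLetter Γ b s) (hab : b ≠ a) :
    exponent a s = 1 := by
  rcases h with rfl | rfl
  · rw [exponent, lift_gen, if_neg hab]
  · rw [map_inv, exponent, lift_gen, if_neg hab, inv_one]

theorem IsLetter.ne_one {a : W} {s : RAAG Γ} (h : IsLetter Γ a s) : s ≠ 1 := by
  rintro rfl
  exact exponent_self_ne h (map_one _)

theorem IsLetter.ne_inv {a : W} {s : RAAG Γ} (h : IsLetter Γ a s) : s ≠ s⁻¹ := by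
  intro e
  have h1 : exponent a s = (exponent a s)⁻¹ := by rw [← map_inv, ← e]
  have h2 := exponent_self_ne h
  refine h2 ?_
  have h3 : Multiplicative.toAdd (exponent a s) = - Multiplicative.toAdd (exponent a s) :=
    congrArg Multiplicative.toAdd h1
  have h4 : Multiplicative.toAdd (exponent a s) = 0 := by omega
  exact Multiplicative.toAdd.injective h4

@[elab_as_elim]
theorem induction_gen {P : RAAG Γ → Prop} (one : P 1) (gen_mem : ∀ a, P (gen Γ a))
    (inv : ∀ x, P x → P x⁻¹) (mul : ∀ x y, P x → P y → P (x * y)) (x : RAAG Γ) : P x := by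
  induction x using PresentedGroup.induction_on with
  | _ z =>
    induction z using FreeGroup.induction_on with
    | C1 => exact one
    | of a => exact gen_mem a
    | inv_of a _ => exact inv _ (gen_mem a)
    | mul x y hx hy => exact mul _ _ hx hy

variable (Γ) in
/-- The Cayley graph. -/
def cayley : SimpleGraph (RAAG Γ) where
  Adj x y := ∃ a, IsLetter Γ a (x⁻¹ * y)
  symm := ⟨fun x y ⟨a, h⟩ => ⟨a, by simpa using h.inv⟩⟩
  loopless := ⟨fun x ⟨a, h⟩ => h.ne_one (by simp)⟩

theorem cayley_adj_mul (x : RAAG Γ) {a : W} {s : RAAG Γ} (h : IsLetter Γ a s) :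
    (cayley Γ).Adj x (x * s) := ⟨a, by simpa using h⟩

theorem reachable_mul (x y : RAAG Γ) : (cayley Γ).Reachable x (x * y) := by
  induction y using RAAG.induction_gen generalizing x with
  | one => rw [mul_one]
  | gen_mem a => exact (cayley_adj_mul x (Or.inl rfl)).reachable
  | inv y ih => simpa using (ih (x * y⁻¹)).symm
  | mul y z hy hz =>
    rw [← mul_assoc]
    exact (hy x).trans (hz _)

variable (Γ) in
/-- The squares of the Cayley complex. -/
def Square (x y y' x' : RAAG Γ) : Prop :=
  ∃ a b s t, Γ.Adj a b ∧ IsLetter Γ a s ∧ IsLetter Γ b t ∧ y = x * s ∧ y' = x * s * t ∧ x' = x * t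

/-- Simple connectivity of the Cayley complex is the universal property of the group: the generators
permute the total space of the covering and respect the commutation relations, so the group acts on
it over right multiplication, and an orbit is a section. -/
theorem exists_section {T : Type*} {act : RAAG Γ → RAAG Γ → T → T} {I : RAAG Γ → Set T}
    (h₁ : ∀ x y, (cayley Γ).Adj x y → ∀ t ∈ I x, act x y t ∈ I y)
    (h₂ : ∀ x y, (cayley Γ).Adj x y → ∀ t ∈ I x, act y x (act x y t) = t)
    (h₃ : ∀ a b c d, Square Γ a b c d → ∀ t ∈ I a, act b c (act a b t) = act d c (act a d t))
    (u : RAAG Γ) (t : T) (ht : t ∈ I u) :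
    ∃ φ : RAAG Γ → T, φ u = t ∧ ∀ x y, (cayley Γ).Adj x y → φ y = act x y (φ x) := by
  let move : ∀ s : RAAG Γ, (∃ a, IsLetter Γ a s) → {p : RAAG Γ × T // p.2 ∈ I p.1} →
      {p : RAAG Γ × T // p.2 ∈ I p.1} := fun s hs p =>
    ⟨(p.1.1 * s, act p.1.1 (p.1.1 * s) p.1.2), h₁ _ _ (cayley_adj_mul _ hs.choose_spec) _ p.2⟩
  have hmove : ∀ s s' hs hs', s * s' = 1 → ∀ p, move s' hs' (move s hs p) = p := by
    intro s s' hs hs' hss p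
    apply Subtype.ext
    have e : p.1.1 * s * s' = p.1.1 := by rw [mul_assoc, hss, mul_one]
    refine Prod.ext e ?_
    change act (p.1.1 * s) (p.1.1 * s * s') (act p.1.1 (p.1.1 * s) p.1.2) = p.1.2
    rw [e]
    exact h₂ _ _ (cayley_adj_mul _ hs.choose_spec) _ p.2
  let σ : W → Equiv.Perm {p : RAAG Γ × T // p.2 ∈ I p.1} := fun a =>
    ⟨move (gen Γ a) ⟨a, Or.inl rfl⟩, move (gen Γ a)⁻¹ ⟨a, Or.inr rfl⟩,
      hmove _ _ ⟨a, Or.inl rfl⟩ ⟨a, Or.inr rfl⟩ (mul_inv_cancel _),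
      hmove _ _ ⟨a, Or.inr rfl⟩ ⟨a, Or.inl rfl⟩ (inv_mul_cancel _)⟩
  -- The opposite group appears because right multiplication reverses the order of composition.
  have hσ : ∀ a b, Γ.Adj a b → Commute (MulOpposite.op (σ a)) (MulOpposite.op (σ b)) := by
    intro a b hab
    have : σ b * σ a = σ a * σ b := by
      ext1 p
      apply Subtype.ext
      have e : p.1.1 * gen Γ a * gen Γ b = p.1.1 * gen Γ b * gen Γ a := by
        rw [mul_assoc, (commute_gen hab).eq, mul_assoc]
      refine Prod.ext e ?_
      change act (p.1.1 * gen Γ a) (p.1.1 * gen Γ a * gen Γ b) (act p.1.1 (p.1.1 * gen Γ a) p.1.2) =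
        act (p.1.1 * gen Γ b) (p.1.1 * gen Γ b * gen Γ a) (act p.1.1 (p.1.1 * gen Γ b) p.1.2)
      rw [← e]
      exact h₃ _ _ _ _ ⟨a, b, _, _, hab, Or.inl rfl, Or.inl rfl, rfl, rfl, rfl⟩ _ p.2
    change _ * _ = _ * _
    rw [← MulOpposite.op_mul, ← MulOpposite.op_mul, this]
  let θ := lift _ hσ
  have hθ : ∀ y p, ((θ y).unop p).1.1 = p.1.1 * y := by
    intro y
    induction y using RAAG.induction_gen with
    | one => intro p; simp
    | gen_mem a => intro p; simp only [θ, lift_gen]; rfl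
    | inv y ih =>
      intro p
      have := ih ((θ y⁻¹).unop p)
      rw [← Equiv.Perm.mul_apply, ← MulOpposite.unop_mul, ← map_mul, inv_mul_cancel,
        map_one] at this
      rw [eq_mul_inv_iff_mul_eq, ← this]
      rfl
    | mul y z hy hz =>
      intro p
      rw [map_mul, MulOpposite.unop_mul, Equiv.Perm.mul_apply, hz, hy, mul_assoc]
  refine ⟨fun x => ((θ (u⁻¹ * x)).unop ⟨(u, t), ht⟩).1.2, by simp, ?_⟩
  rintro x y ⟨a, hs⟩
  obtain ⟨s, hs', rfl⟩ : ∃ s, IsLetter Γ a s ∧ y = x * s := ⟨_, hs, by simp⟩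
  have hx := hθ (u⁻¹ * x) ⟨(u, t), ht⟩
  rw [mul_inv_cancel_left] at hx
  simp only
  rw [← mul_assoc, map_mul, MulOpposite.unop_mul, Equiv.Perm.mul_apply]
  generalize (θ (u⁻¹ * x)).unop ⟨(u, t), ht⟩ = p at hx ⊢
  subst hx
  rcases hs' with rfl | rfl
  · simp only [θ, lift_gen]
    rfl
  · simp only [θ, map_inv, lift_gen]
    rfl

variable (Γ) in
/-- The Cayley complex of a right-angled Artin group. -/
def squareComplex : SquareComplex (RAAG Γ) where
  graph := cayley Γ
  Sq := Square Γ
  connected := by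
    have : Nonempty (RAAG Γ) := ⟨1⟩
    exact ⟨fun x y => by simpa using reachable_mul x (x⁻¹ * y)⟩
  adj := by
    rintro x _ _ _ ⟨a, b, s, t, -, hs, -, rfl, rfl, rfl⟩
    exact cayley_adj_mul x hs
  ne := by
    rintro x _ _ _ ⟨a, b, s, t, hab, hs, ht, rfl, rfl, rfl⟩ e
    have : s * t = 1 := by
      rw [mul_assoc] at e
      exact (mul_eq_left.1 e.symm)
    have h1 : exponent a (s * t) = 1 := by rw [this, map_one]
    rw [map_mul, exponent_of_ne ht hab.ne.symm, mul_one] at h1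
    exact exponent_self_ne hs h1
  rotate := by
    rintro x _ _ _ ⟨a, b, s, t, hab, hs, ht, rfl, rfl, rfl⟩
    refine ⟨b, a, t, s⁻¹, hab.symm, ht, hs.inv, rfl, ?_, by simp⟩
    rw [mul_assoc x s t, hs.commute ht hab]
    simp [mul_assoc]
  flip := by
    rintro x _ _ _ ⟨a, b, s, t, hab, hs, ht, rfl, rfl, rfl⟩
    refine ⟨b, a, t, s, hab.symm, ht, hs, rfl, ?_, rfl⟩
    rw [mul_assoc, hs.commute ht hab, mul_assoc]
  unique := by
    rintro x _ _ _ _ ⟨a, b, s, t, -, -, -, rfl, rfl, rfl⟩ ⟨a', b', s', t', -, -, -, h1, h2, rfl⟩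
    rw [mul_right_inj] at h1
    subst h1
    rw [mul_right_inj] at h2
    rw [h2]
  cube := by
    rintro v _ _ _ _ _ _ ⟨a₁, b₁, s, t, h₁, hs₁, ht₁, rfl, rfl, rfl⟩
      ⟨a₂, b₂, t', r, h₂, hs₂, ht₂, e₁, rfl, rfl⟩ ⟨a₃, b₃, r', s', h₃, hs₃, ht₃, e₂, rfl, e₃⟩
    rw [mul_right_inj] at e₁ e₂ e₃
    subst e₁ e₂ e₃
    have c₁ := hs₁.commute ht₁ h₁
    have c₂ := hs₂.commute ht₂ h₂
    have c₃ := hs₃.commute ht₃ h₃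
    refine ⟨v * s * t * r, ⟨a₂, b₂, t, r, h₂, hs₂, ht₂, rfl, rfl, ?_⟩,
      ⟨a₃, b₃, r, s, h₃, hs₃, ht₃, rfl, ?_, ?_⟩, ⟨a₁, b₁, s, t, h₁, hs₁, ht₁, rfl, ?_, ?_⟩⟩
    · rw [mul_assoc, c₃, mul_assoc]
    · rw [mul_assoc (v * t) r s, c₃, ← mul_assoc, mul_assoc v s t, c₁, ← mul_assoc]
    · rw [mul_assoc, c₁, mul_assoc]
    · rw [mul_assoc (v * s) t r, c₂, ← mul_assoc, mul_assoc v s r, ← c₃, ← mul_assoc]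
    · rw [mul_assoc, c₂, mul_assoc]
  develop _ _ _ h₁ h₂ h₃ := exists_section h₁ h₂ h₃

/-- The generators labelling a square commute, so its opposite edges carry equal labels. -/
theorem label_eq {a b x y : RAAG Γ} (h : (squareComplex Γ).OPar a b x y) :
    a⁻¹ * b = x⁻¹ * y := by
  induction h with
  | refl => rfl
  | step _ hq ih =>
    obtain ⟨a, b, s, t, hab, hs, ht, rfl, rfl, rfl⟩ := hq
    rw [ih, mul_assoc _ s t, hs.commute ht hab]
    simp [mul_assoc]

theorem cayley_adj_smul (g : RAAG Γ) {x y : RAAG Γ} (h : (squareComplex Γ).graph.Adj x y) :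
    (squareComplex Γ).graph.Adj (g • x) (g • y) := by
  obtain ⟨a, h⟩ := h
  exact ⟨a, by simpa [mul_assoc] using h⟩

/-- The label of dual edges is invariant under left translation. An inversion would equate a letter
with its inverse, a transverse translate would give a square with two equal labels at a corner, and
an osculating one a path `x`, `y`, `z` with `x = z`. -/
theorem tameAction : (squareComplex Γ).TameAction (RAAG Γ) where
  adj := cayley_adj_smul
  no_inversion := by
    rintro _ ⟨a, b, hab, rfl⟩ h e
    rw [SquareComplex.smul_half cayley_adj_smul, SquareComplex.compl_half hab] at e
    have := label_eq (SquareComplex.opar_of_half_eq (cayley_adj_smul h hab) hab.symm e)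
    obtain ⟨c, hc⟩ := hab
    refine hc.ne_inv ?_
    simpa [mul_assoc] using this
  nested := by
    rintro _ ⟨a, b, hab, rfl⟩ h
    by_contra hn
    have hab' := cayley_adj_smul h hab
    rw [SquareComplex.smul_half cayley_adj_smul] at hn
    obtain ⟨x, y, y', x', hq, e1, e2⟩ := SquareComplex.exists_square_of_transverse
      (SquareComplex.half_mem hab) (SquareComplex.half_mem hab') hn
    have l1 := label_eq (SquareComplex.opar_of_half_eq hab ((squareComplex Γ).adj hq) e1)
    have l2 := label_eq (SquareComplex.opar_of_half_eq hab'
      ((squareComplex Γ).adj ((squareComplex Γ).flip hq)) e2)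
    have l3 : (h • a)⁻¹ * h • b = a⁻¹ * b := by simp [mul_assoc]
    rw [l3, l1, mul_right_inj] at l2
    exact (squareComplex Γ).ne ((squareComplex Γ).rotate hq) l2
  no_osculation := by
    rintro _ ⟨a, b, hab, rfl⟩ h hlt
    by_contra hn
    have hab' := cayley_adj_smul h hab
    rw [SquareComplex.smul_half cayley_adj_smul] at hlt hn
    obtain ⟨x, y, z, hxy, hyz, e1, e2⟩ := SquareComplex.exists_path_of_tight
      (SquareComplex.half_mem hab) (SquareComplex.compl_mem (SquareComplex.half_mem hab')) hlt hn
    have e3 : (squareComplex Γ).half (h • a) (h • b) = (squareComplex Γ).half z y := by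
      rw [← compl_compl ((squareComplex Γ).half (h • a) (h • b)), e2, SquareComplex.compl_half hyz]
    have l1 := label_eq (SquareComplex.opar_of_half_eq hab hxy e1)
    have l2 := label_eq (SquareComplex.opar_of_half_eq hab' hyz.symm e3)
    have l3 : (h • a)⁻¹ * h • b = a⁻¹ * b := by simp [mul_assoc]
    rw [l3, l1, mul_left_inj, inv_inj] at l2
    subst l2
    have hx : x ∈ (squareComplex Γ).half a b := by
      rw [e1]; exact SquareComplex.left_mem_half hxy
    have hx' := hlt.subset hx
    rw [e2] at hx'
    exact SquareComplex.right_notMem_half hx'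

end RAAG

theorem mainTheorem2 :
    (∀ (G : Type u) [Group G] (V : Type v) [MulAction G V] (X : CubeComplex V),
      X.IsCAT0 → X.IsRAAGLikeAction G →
        ∀ g ∈ commutator G, (∃ x : V, g • x ≠ x) → SclAtLeast g (1 / 24)) ∧
    (∀ (G : Type u) [Group G], IsRAAGLikeGroup.{u, v} G → HasSclGap G (1 / 24)) ∧
    (∀ (W : Type w) (Γ : SimpleGraph W), HasSclGap (RAAG Γ) (1 / 24)) := by
  refine ⟨?_, ?_, ?_⟩
  · intro G _ V _ X hX H g hg hne
    exact (H.tameAction hX).sclAtLeast hg hne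
  · rintro G _ ⟨V, _, X, hX, H, hfaithful⟩ g hg hne
    refine (H.tameAction hX).sclAtLeast hg ?_
    by_contra hn
    push Not at hn
    exact hne (hfaithful.eq_of_smul_eq_smul fun x => by rw [hn x, one_smul])
  · intro W Γ g hg hne
    refine RAAG.tameAction.sclAtLeast hg ⟨1, ?_⟩
    simpa using hne
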